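/- Let $\alpha,\kappa\ge 0$, $0<\beta<1$, $\eta\ge 0$ and $\gamma>\eta^2$ (hence $\gamma>0$). All functions are complex valued. For $m=1,2$ let $H^m_*(0,1)=\{w\in H^m(0,1): w(1)=0\}$, let $H^2_*(\mathbf G)$ be the space of triples $w=(w_1,w_2,w_3)$ with $w_k\in H^2_*(0,1)$ and $w_j(0)=w_k(0)$ for $j,k=1,2,3$, and let $L_2(\mathbf G)=L_2(0,1)^3$. Let $\mathscr X=H^2_*(\mathbf G)\times L_2(\mathbf G)$ be the Hilbert space of pairs $x=(w,v)$ with inner product $$(x,\tilde x)_{\mathscr X}=\sum_{k=1}^3\Big[\int_0^1 w_k''\overline{\tilde w_k''}\,ds+(\gamma-\eta^2)\int_0^1 w_k'\overline{\tilde w_k'}\,ds+\alpha\, w_k'(0)\overline{\tilde w_k'(0)}\Big]+\sum_{k=1}^3\int_0^1 v_k\overline{\tilde v_k}\,ds .$$ Let $\mathscr D(\mathcal A)$ be the set of all $x=(w,v)\in\mathscr X$ such that $w_k\in H^4(0,1)$ for $k=1,2,3$, $v\in H^2_*(\mathbf G)$, and $$w_k''(1)=0,\qquad w_k''(0)-\alpha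 w_k'(0)-\kappa v_k'(0)=0\quad(k=1,2,3),\qquad \sum_{k=1}^3\big[w_k^{(3)}(0)-(\gamma-\eta^2)w_k'(0)+\beta\eta\, v_k(0)\big]=0 ,$$ and let $\mathcal A(w,v)=\big(v,\{-w_k^{(4)}+(\gamma-\eta^2)w_k''\}_{k=1}^3\big)$ on this domain. Let $\mathcal B(w,v)=\big(0,\{-2\beta\eta\, v_k'\}_{k=1}^3\big)$ on $\mathscr D(\mathcal B)=\{(w,v)\in\mathscr X: v_k\in H^1_*(0,1),\ k=1,2,3\}$, and let $\mathcal T=\mathcal A+\mathcal B$ on $\mathscr D(\mathcal T)=\mathscr D(\mathcal A)$. Then $\mathcal T$ is the infinitesimal generator of a contractive $C_0$-semigroup $(\mathbb S(t))_{t\ge 0}$ on $\mathscr X$, and for every $x_0\in\mathscr D(\mathcal A)$ the closed-loop system $$\dot x(t)=\mathcal T x(t)\quad(t>0),\qquad x(0)=x_0,$$ has a unique solution $x\in C^1((0,\infty);\mathscr X)\cap C([0,\infty);\mathscr D(\mathcal A))$, where $\mathscr D(\mathcal A)$ carries the graph norm; it is given by $x(t)=\mathbb S(t)x_0$. -/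

import Mathlib

open MeasureTheory Set Filter Topology
open scoped ContDiff

noncomputable section
namespace PipeNetwork

/-! ### Lebesgue space and weak derivatives on the unit interval -/

/-- Lebesgue measure on `(0,1)`. -/
abbrev unitMeasure : Measure ℝ := volume.restrict (Ioo (0 : ℝ) 1)

/-- The complex Hilbert space `L₂(0,1)`. -/
abbrev L2 : Type := Lp ℂ 2 unitMeasure

/-- `φ ∈ C_c^∞(0,1)`. -/
structure IsTestFunction (φ : ℝ → ℝ) : Prop where
  contDiff : ContDiff ℝ ∞ φ
  hasCompactSupport : HasCompactSupport φ
  tsupport_subset : tsupport φ ⊆ Ioo 0 1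

/-- `g` is the weak derivative of `f` on `(0,1)`: `∫ φ' f = -∫ φ g` for all `φ ∈ C_c^∞(0,1)`. -/
def HasWeakDeriv (f g : L2) : Prop :=
  ∀ φ : ℝ → ℝ, IsTestFunction φ →
    ∫ s in Ioo (0 : ℝ) 1, deriv φ s • f s = -∫ s in Ioo (0 : ℝ) 1, φ s • g s

lemma integrable_coe (f : L2) : Integrable f unitMeasure :=
  (Lp.memLp f).integrable one_le_two

lemma IsTestFunction.deriv {φ : ℝ → ℝ} (h : IsTestFunction φ) : IsTestFunction (deriv φ) :=
  ⟨(contDiff_infty_iff_deriv.1 h.contDiff).2, h.hasCompactSupport.deriv,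
    (tsupport_deriv_subset ..).trans h.tsupport_subset⟩

lemma IsTestFunction.integrable_smul {φ : ℝ → ℝ} (h : IsTestFunction φ) {f : ℝ → ℂ}
    (hf : Integrable f unitMeasure) : Integrable (fun s => φ s • f s) unitMeasure :=
  hf.locallyIntegrable.integrable_smul_left_of_hasCompactSupport h.contDiff.continuous
    h.hasCompactSupport

lemma HasWeakDeriv.add {f g f' g' : L2} (h : HasWeakDeriv f g) (h' : HasWeakDeriv f' g') :
    HasWeakDeriv (f + f') (g + g') := by
  intro φ hφ
  have e1 : ∫ s in Ioo (0 : ℝ) 1, _root_.deriv φ s • (f + f') s =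
      ∫ s in Ioo (0 : ℝ) 1, (_root_.deriv φ s • f s + _root_.deriv φ s • f' s) := by
    refine integral_congr_ae ?_
    filter_upwards [Lp.coeFn_add f f'] with s hs
    rw [hs, Pi.add_apply, smul_add]
  have e2 : ∫ s in Ioo (0 : ℝ) 1, φ s • (g + g') s =
      ∫ s in Ioo (0 : ℝ) 1, (φ s • g s + φ s • g' s) := by
    refine integral_congr_ae ?_
    filter_upwards [Lp.coeFn_add g g'] with s hs
    rw [hs, Pi.add_apply, smul_add]
  rw [e1, e2, integral_add (hφ.deriv.integrable_smul (integrable_coe f))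
    (hφ.deriv.integrable_smul (integrable_coe f')),
    integral_add (hφ.integrable_smul (integrable_coe g))
    (hφ.integrable_smul (integrable_coe g')), h φ hφ, h' φ hφ]
  ring

lemma HasWeakDeriv.smul {f g : L2} (c : ℂ) (h : HasWeakDeriv f g) :
    HasWeakDeriv (c • f) (c • g) := by
  intro φ hφ
  have e1 : ∫ s in Ioo (0 : ℝ) 1, _root_.deriv φ s • (c • f) s =
      ∫ s in Ioo (0 : ℝ) 1, c • (_root_.deriv φ s • f s) := by
    refine integral_congr_ae ?_
    filter_upwards [Lp.coeFn_smul c f] with s hs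
    rw [hs, Pi.smul_apply, smul_comm]
  have e2 : ∫ s in Ioo (0 : ℝ) 1, φ s • (c • g) s =
      ∫ s in Ioo (0 : ℝ) 1, c • (φ s • g s) := by
    refine integral_congr_ae ?_
    filter_upwards [Lp.coeFn_smul c g] with s hs
    rw [hs, Pi.smul_apply, smul_comm]
  rw [e1, e2, integral_smul, integral_smul, h φ hφ, smul_neg]

lemma HasWeakDeriv.zero : HasWeakDeriv 0 0 := by
  intro φ _
  rw [integral_eq_zero_of_ae, integral_eq_zero_of_ae, neg_zero] <;>
  · filter_upwards [Lp.coeFn_zero ℂ 2 unitMeasure] with s hs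
    rw [hs]; simp

lemma HasWeakDeriv.unique {f g g' : L2} (h : HasWeakDeriv f g) (h' : HasWeakDeriv f g') :
    g = g' := by
  have h0 : HasWeakDeriv 0 (g - g') := by
    have := h.add (h'.smul (-1))
    simpa [sub_eq_add_neg] using this
  have key : ∀ᵐ x ∂(volume : Measure ℝ), x ∈ Ioo (0 : ℝ) 1 → (g - g' : L2) x = 0 := by
    refine isOpen_Ioo.ae_eq_zero_of_integral_contDiff_smul_eq_zero ?_ ?_
    · have : IntegrableOn (g - g' : L2) (Ioo 0 1) := integrable_coe (g - g')
      exact this.locallyIntegrableOn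
    · intro φ h1 h2 h3
      have hφ : IsTestFunction φ := ⟨h1, h2, h3⟩
      have e := h0 φ hφ
      have e0 : ∫ s in Ioo (0 : ℝ) 1, _root_.deriv φ s • (0 : L2) s = 0 := by
        refine integral_eq_zero_of_ae ?_
        filter_upwards [Lp.coeFn_zero ℂ 2 unitMeasure] with s hs
        rw [hs]; simp
      rw [e0] at e
      rw [← setIntegral_eq_integral_of_forall_compl_eq_zero (s := Ioo 0 1)]
      · simpa using e.symm
      · intro x hx
        have : φ x = 0 := image_eq_zero_of_notMem_tsupport fun hh => hx (h3 hh)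
        simp [this]
  have : g - g' = 0 := by
    refine Lp.ext ?_
    have := (ae_restrict_iff' (measurableSet_Ioo)).2 key
    filter_upwards [this, Lp.coeFn_zero ℂ 2 unitMeasure] with s hs h0
    rw [hs, h0]; rfl
  exact sub_eq_zero.1 this

/-- A function on `(0,1)` with vanishing weak derivative is constant. -/
lemma ae_const_of_integral_deriv_smul_eq_zero {f : ℝ → ℂ} (hf : Integrable f unitMeasure)
    (h : ∀ φ : ℝ → ℝ, IsTestFunction φ → ∫ s in Ioo (0 : ℝ) 1, deriv φ s • f s = 0) :
    ∃ c : ℂ, f =ᵐ[unitMeasure] fun _ => c := by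
  let b : ContDiffBump (1 / 2 : ℝ) := ⟨1 / 8, 1 / 4, by norm_num, by norm_num⟩
  set ψ₀ : ℝ → ℝ := b.normed volume with hψ₀
  have ht₀ : IsTestFunction ψ₀ := by
    refine ⟨b.contDiff_normed, b.hasCompactSupport_normed, ?_⟩
    rw [hψ₀, b.tsupport_normed_eq, Real.closedBall_eq_Icc]
    intro x hx
    have h1 := hx.1
    have h2 := hx.2
    constructor <;> norm_num [b] at * <;> linarith
  have hi₀ : ∫ x, ψ₀ x = 1 := b.integral_normed
  have hcs : ∀ ψ : ℝ → ℝ, IsTestFunction ψ → ∫ x in Ioo (0 : ℝ) 1, ψ x = ∫ x, ψ x := by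
    intro ψ hψ
    refine setIntegral_eq_integral_of_forall_compl_eq_zero fun x hx => ?_
    exact image_eq_zero_of_notMem_tsupport fun hh => hx (hψ.tsupport_subset hh)
  refine ⟨∫ s in Ioo (0 : ℝ) 1, ψ₀ s • f s, ?_⟩
  set c := ∫ s in Ioo (0 : ℝ) 1, ψ₀ s • f s with hc
  have key : ∀ᵐ x ∂(volume : Measure ℝ), x ∈ Ioo (0 : ℝ) 1 → f x - c = 0 := by
    refine isOpen_Ioo.ae_eq_zero_of_integral_contDiff_smul_eq_zero ?_ ?_
    · have : IntegrableOn (fun x => f x - c) (Ioo 0 1) := hf.sub (integrable_const c)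
      exact this.locallyIntegrableOn
    intro ψ h1 h2 h3
    have hψ : IsTestFunction ψ := ⟨h1, h2, h3⟩
    rw [← setIntegral_eq_integral_of_forall_compl_eq_zero (s := Ioo 0 1)]
    swap
    · intro x hx
      have : ψ x = 0 := image_eq_zero_of_notMem_tsupport fun hh => hx (h3 hh)
      simp [this]
    set m := ∫ x, ψ x with hm
    set χ : ℝ → ℝ := fun x => ψ x - m * ψ₀ x with hχ
    have cχ : ContDiff ℝ ∞ χ := h1.sub (contDiff_const.mul ht₀.contDiff)
    have sχ : HasCompactSupport χ := h2.sub (ht₀.hasCompactSupport.mul_left)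
    have iχ : Integrable χ := cχ.continuous.integrable_of_hasCompactSupport sχ
    have zχ : ∫ x, χ x = 0 := by
      rw [hχ, integral_sub (h1.continuous.integrable_of_hasCompactSupport h2)
        ((ht₀.contDiff.continuous.integrable_of_hasCompactSupport
          ht₀.hasCompactSupport).const_mul m), integral_const_mul, hi₀]
      simp [hm]
    have tχ : tsupport χ ⊆ Ioo 0 1 := by
      refine (tsupport_sub _ _).trans (union_subset h3 ?_)
      exact (tsupport_mul_subset_right).trans ht₀.tsupport_subset
    set φ : ℝ → ℝ := fun t => ∫ x in Iic t, χ x with hφ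
    have dφ : ∀ t, HasDerivAt φ (χ t) t := by
      intro t
      have e : φ = fun t => (∫ x in Iic 0, χ x) + ∫ x in (0 : ℝ)..t, χ x := by
        funext t
        rw [← intervalIntegral.integral_Iic_sub_Iic iχ.integrableOn iχ.integrableOn]
        simp [hφ]
      rw [e]
      exact (intervalIntegral.integral_hasDerivAt_right (iχ.intervalIntegrable)
        (cχ.continuous.stronglyMeasurableAtFilter _ _) cχ.continuous.continuousAt).const_add _
    have dφ' : deriv φ = χ := funext fun t => (dφ t).deriv
    obtain ⟨a, b', ha, hb, hab⟩ : ∃ a b' : ℝ, 0 < a ∧ b' < 1 ∧ tsupport χ ⊆ Icc a b' := by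
      have hK : IsCompact (insert (1 / 2 : ℝ) (tsupport χ)) := IsCompact.insert sχ _
      have hne : (insert (1 / 2 : ℝ) (tsupport χ)).Nonempty := insert_nonempty _ _
      have hsub : insert (1 / 2 : ℝ) (tsupport χ) ⊆ Ioo 0 1 :=
        insert_subset (by norm_num) tχ
      refine ⟨sInf _, sSup _, (hsub (hK.sInf_mem hne)).1, (hsub (hK.sSup_mem hne)).2, ?_⟩
      intro x hx
      exact ⟨csInf_le hK.bddBelow (mem_insert_of_mem _ hx),
        le_csSup hK.bddAbove (mem_insert_of_mem _ hx)⟩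
    have suppφ : tsupport φ ⊆ Icc a b' := by
      refine closure_minimal ?_ isClosed_Icc
      intro t ht
      by_contra hn
      apply ht
      have hz : ∀ x, x ∉ Icc a b' → χ x = 0 := fun x hx =>
        image_eq_zero_of_notMem_tsupport fun hh => hx (hab hh)
      by_cases hta : t < a
      · refine setIntegral_eq_zero_of_forall_eq_zero fun x hx => hz x fun hh => ?_
        exact absurd (hh.1.trans hx) (not_le.2 hta)
      · have htb : b' < t := by
          by_contra hcon
          exact hn ⟨not_lt.1 hta, not_lt.1 hcon⟩
        simp only [hφ]
        rw [setIntegral_eq_integral_of_forall_compl_eq_zero, zχ]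
        intro x hx
        refine hz x fun hh => hx (hh.2.trans htb.le)
    have tφ : IsTestFunction φ := by
      refine ⟨contDiff_infty_iff_deriv.2 ⟨fun t => (dφ t).differentiableAt, dφ' ▸ cχ⟩, ?_, ?_⟩
      · exact isCompact_Icc.of_isClosed_subset (isClosed_tsupport φ) suppφ
      · exact suppφ.trans fun x hx => ⟨ha.trans_le hx.1, hx.2.trans_lt hb⟩
    have e := h φ tφ
    rw [dφ'] at e
    have e1 : ∫ s in Ioo (0 : ℝ) 1, χ s • f s
        = (∫ s in Ioo (0 : ℝ) 1, ψ s • f s) - m * c := by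
      rw [hc, ← integral_const_mul, ← integral_sub (hψ.integrable_smul hf)
        ((ht₀.integrable_smul hf).const_mul _)]
      refine integral_congr_ae (Eventually.of_forall fun s => ?_)
      simp [hχ]; ring
    have e2 : ∫ s in Ioo (0 : ℝ) 1, ψ s • (f s - c)
        = (∫ s in Ioo (0 : ℝ) 1, ψ s • f s) - m * c := by
      have : ∫ s in Ioo (0 : ℝ) 1, ψ s • c = m * c := by
        rw [integral_smul_const, hcs ψ hψ]; simp [hm]
      rw [← this, ← integral_sub (hψ.integrable_smul hf)
        (hψ.integrable_smul (integrable_const c))]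
      simp_rw [smul_sub]
    rw [e2, ← e1, e]
  filter_upwards [(ae_restrict_iff' measurableSet_Ioo).2 key] with x hx
  exact sub_eq_zero.1 hx

lemma integral_deriv_mul_primitive {g : ℝ → ℝ} (hg : Integrable g unitMeasure)
    {φ : ℝ → ℝ} (hφ : IsTestFunction φ) :
    ∫ s in Ioo (0 : ℝ) 1, deriv φ s * ∫ r in (0 : ℝ)..s, g r
      = -∫ s in Ioo (0 : ℝ) 1, φ s * g s := by
  have hi : IntervalIntegrable g volume 0 1 := by
    rw [intervalIntegrable_iff_integrableOn_Ioo_of_le zero_le_one]; exact hg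
  have acF := hi.absolutelyContinuousOnInterval_intervalIntegral (c := 0) (by simp)
  have acφ : AbsolutelyContinuousOnInterval φ 0 1 :=
    (hφ.contDiff.of_le (by exact_mod_cast le_top)).contDiffOn.absolutelyContinuousOnInterval
  have z0 : φ 0 = 0 := image_eq_zero_of_notMem_tsupport fun hh =>
    absurd (hφ.tsupport_subset hh).1 (lt_irrefl _)
  have z1 : φ 1 = 0 := image_eq_zero_of_notMem_tsupport fun hh =>
    absurd (hφ.tsupport_subset hh).2 (lt_irrefl _)
  have e := acF.integral_mul_deriv_eq_deriv_mul acφ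
  have e' : ∫ x in (0 : ℝ)..1, deriv (fun x => ∫ v in (0 : ℝ)..x, g v) x * φ x
      = ∫ x in (0 : ℝ)..1, φ x * g x := by
    refine intervalIntegral.integral_congr_ae ?_
    filter_upwards [hi.ae_hasDerivAt_integral] with x hx hx'
    rw [(hx (uIoc_subset_uIcc hx') 0 (by simp)).deriv, mul_comm]
  rw [e', z0, z1] at e
  rw [← integral_Ioc_eq_integral_Ioo, ← integral_Ioc_eq_integral_Ioo,
    ← intervalIntegral.integral_of_le zero_le_one, ← intervalIntegral.integral_of_le zero_le_one]
  simp only [mul_zero, sub_zero, zero_sub] at e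
  rw [← e]
  simp_rw [mul_comm]

/-- A weakly differentiable class is the primitive of its weak derivative, up to a constant. -/
lemma HasWeakDeriv.exists_continuous {f g : L2} (h : HasWeakDeriv f g) :
    ∃ c : ℂ, f =ᵐ[unitMeasure] fun t => c + ∫ r in (0 : ℝ)..t, g r := by
  have hgi := integrable_coe g
  have hi : IntervalIntegrable g volume 0 1 := by
    rw [intervalIntegrable_iff_integrableOn_Ioo_of_le zero_le_one]; exact hgi
  set F : ℝ → ℂ := fun t => ∫ r in (0 : ℝ)..t, g r with hF
  have cF : ContinuousOn F (Icc 0 1) :=by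
    have := intervalIntegral.continuousOn_primitive_interval' hi (a := 0) (by simp)
    rwa [uIcc_of_le zero_le_one] at this
  have iF : Integrable F unitMeasure :=
    (cF.integrableOn_Icc).mono_set Ioo_subset_Icc_self
  have hFw : ∀ φ : ℝ → ℝ, IsTestFunction φ →
      ∫ s in Ioo (0 : ℝ) 1, _root_.deriv φ s • F s = -∫ s in Ioo (0 : ℝ) 1, φ s • g s := by
    intro φ hφ
    have hF' := hφ.deriv.integrable_smul iF
    have hG' := hφ.integrable_smul hgi
    have hFre : ∀ s ∈ Ioo (0 : ℝ) 1, (F s).re = ∫ r in (0 : ℝ)..s, (g r).re := by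
      intro s hs
      have his : IntervalIntegrable g volume 0 s :=
        hi.mono_set (by rw [uIcc_of_le hs.1.le, uIcc_of_le zero_le_one]; exact Icc_subset_Icc le_rfl hs.2.le)
      exact (intervalIntegral.intervalIntegral_re his).symm
    have hFim : ∀ s ∈ Ioo (0 : ℝ) 1, (F s).im = ∫ r in (0 : ℝ)..s, (g r).im := by
      intro s hs
      have his : IntervalIntegrable g volume 0 s :=
        hi.mono_set (by rw [uIcc_of_le hs.1.le, uIcc_of_le zero_le_one]; exact Icc_subset_Icc le_rfl hs.2.le)
      exact (intervalIntegral.intervalIntegral_im his).symm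
    apply Complex.ext
    · have e := integral_deriv_mul_primitive hgi.re hφ
      have a1 := integral_re hF'
      have a2 := integral_re hG'
      simp only [RCLike.re_to_complex, Complex.real_smul, Complex.re_ofReal_mul] at a1 a2 e
      rw [Complex.neg_re]
      simp only [Complex.real_smul]
      rw [← a1, ← a2, ← e]
      exact setIntegral_congr_fun measurableSet_Ioo fun s hs => by simp only [hFre s hs]
    · have e := integral_deriv_mul_primitive hgi.im hφ
      have a1 := integral_im hF'
      have a2 := integral_im hG'
      simp only [RCLike.im_to_complex, Complex.real_smul, Complex.im_ofReal_mul] at a1 a2 e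
      rw [Complex.neg_im]
      simp only [Complex.real_smul]
      rw [← a1, ← a2, ← e]
      exact setIntegral_congr_fun measurableSet_Ioo fun s hs => by simp only [hFim s hs]
  obtain ⟨c, hc⟩ := ae_const_of_integral_deriv_smul_eq_zero ((integrable_coe f).sub iF) (by
    intro φ hφ
    simp only [Pi.sub_apply, smul_sub]
    rw [integral_sub (hφ.deriv.integrable_smul (integrable_coe f))
      (hφ.deriv.integrable_smul iF), h φ hφ, hFw φ hφ, sub_self])
  refine ⟨c, ?_⟩
  filter_upwards [hc] with s hs
  rw [← hs, Pi.sub_apply, sub_add_cancel]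
/-! ### Boundary values, Sobolev spaces -/

open Classical in
/-- The weak derivative of `f` (the zero class if `f` has none in `L₂(0,1)`). -/
def weakDeriv (f : L2) : L2 := if h : ∃ g, HasWeakDeriv f g then h.choose else 0

/-- `u` is a representative of the class `f` that is continuous on the closed interval `[0,1]`. -/
def IsContinuousRep (f : L2) (u : ℝ → ℂ) : Prop :=
  ContinuousOn u (Icc 0 1) ∧ f =ᵐ[unitMeasure] u

open Classical in
/-- The value `f(p)` at `p ∈ [0,1]` of the continuous representative of `f`
(zero if there is none). -/
def pointValue (f : L2) (p : ℝ) : ℂ := if h : ∃ u, IsContinuousRep f u then h.choose p else 0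

/-- The classes that have a weak derivative in `V`. -/
def havingWeakDerivIn (V : Submodule ℂ L2) : Submodule ℂ L2 where
  carrier := {f | ∃ g ∈ V, HasWeakDeriv f g}
  add_mem' := fun ⟨g, hg, h⟩ ⟨g', hg', h'⟩ => ⟨g + g', add_mem hg hg', h.add h'⟩
  zero_mem' := ⟨0, zero_mem _, HasWeakDeriv.zero⟩
  smul_mem' := fun c _ ⟨g, hg, h⟩ => ⟨c • g, Submodule.smul_mem _ c hg, h.smul c⟩

/-- The Sobolev space `Hᵐ(0,1)`: `H⁰ = L₂`, and `f ∈ Hᵐ⁺¹` if `f` has a weak derivative in `Hᵐ`. -/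
def sobolev : ℕ → Submodule ℂ L2
  | 0 => ⊤
  | m + 1 => havingWeakDerivIn (sobolev m)

lemma HasWeakDeriv.weakDeriv_eq {f g : L2} (h : HasWeakDeriv f g) : weakDeriv f = g := by
  have h' : ∃ g, HasWeakDeriv f g := ⟨g, h⟩
  rw [weakDeriv, dif_pos h']
  exact h'.choose_spec.unique h

lemma IsContinuousRep.pointValue_eq {f : L2} {u : ℝ → ℂ} (h : IsContinuousRep f u) {p : ℝ}
    (hp : p ∈ Icc (0 : ℝ) 1) : pointValue f p = u p := by
  have h' : ∃ u, IsContinuousRep f u := ⟨u, h⟩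
  rw [pointValue, dif_pos h']
  have e : h'.choose =ᵐ[volume.restrict (Icc (0 : ℝ) 1)] u := by
    rw [← restrict_Ioo_eq_restrict_Icc]
    exact h'.choose_spec.2.symm.trans h.2
  exact Measure.eqOn_Icc_of_ae_eq volume zero_ne_one e h'.choose_spec.1 h.1 hp

lemma mem_sobolev_succ {m : ℕ} {f : L2} :
    f ∈ sobolev (m + 1) ↔ ∃ g ∈ sobolev m, HasWeakDeriv f g := Iff.rfl

lemma hasWeakDeriv_of_mem {m : ℕ} {f : L2} (hf : f ∈ sobolev (m + 1)) :
    HasWeakDeriv f (weakDeriv f) := by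
  obtain ⟨g, -, h⟩ := hf
  rwa [h.weakDeriv_eq]

lemma weakDeriv_mem {m : ℕ} {f : L2} (hf : f ∈ sobolev (m + 1)) : weakDeriv f ∈ sobolev m := by
  obtain ⟨g, hg, h⟩ := hf
  rwa [h.weakDeriv_eq]

lemma sobolev_succ_le : ∀ m : ℕ, sobolev (m + 1) ≤ sobolev m
  | 0 => fun _ _ => Submodule.mem_top
  | m + 1 => fun _ ⟨g, hg, h⟩ => ⟨g, sobolev_succ_le m hg, h⟩

lemma sobolev_antitone : Antitone sobolev := antitone_nat_of_succ_le sobolev_succ_le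

lemma iterate_weakDeriv_mem (n : ℕ) : ∀ {m : ℕ} {f : L2}, f ∈ sobolev (m + n) →
    weakDeriv^[n] f ∈ sobolev m := by
  induction n with
  | zero => intro m f hf; exact hf
  | succ n ih =>
    intro m f hf
    rw [Function.iterate_succ_apply]
    exact ih (weakDeriv_mem hf)

lemma weakDeriv_add {f g : L2} (hf : f ∈ sobolev 1) (hg : g ∈ sobolev 1) :
    weakDeriv (f + g) = weakDeriv f + weakDeriv g :=
  ((hasWeakDeriv_of_mem hf).add (hasWeakDeriv_of_mem hg)).weakDeriv_eq

lemma weakDeriv_smul (c : ℂ) {f : L2} (hf : f ∈ sobolev 1) :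
    weakDeriv (c • f) = c • weakDeriv f :=
  ((hasWeakDeriv_of_mem hf).smul c).weakDeriv_eq

lemma weakDeriv_zero : weakDeriv 0 = 0 := HasWeakDeriv.zero.weakDeriv_eq

lemma iterate_weakDeriv_add (n : ℕ) : ∀ {f g : L2}, f ∈ sobolev n → g ∈ sobolev n →
    weakDeriv^[n] (f + g) = weakDeriv^[n] f + weakDeriv^[n] g := by
  induction n with
  | zero => intro f g _ _; rfl
  | succ n ih =>
    intro f g hf hg
    simp only [Function.iterate_succ_apply]
    rw [weakDeriv_add (sobolev_antitone (by omega) hf) (sobolev_antitone (by omega) hg)]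
    exact ih (weakDeriv_mem hf) (weakDeriv_mem hg)

lemma iterate_weakDeriv_smul (n : ℕ) (c : ℂ) : ∀ {f : L2}, f ∈ sobolev n →
    weakDeriv^[n] (c • f) = c • weakDeriv^[n] f := by
  induction n with
  | zero => intro f _; rfl
  | succ n ih =>
    intro f hf
    simp only [Function.iterate_succ_apply]
    rw [weakDeriv_smul c (sobolev_antitone (by omega) hf)]
    exact ih (weakDeriv_mem hf)

lemma iterate_weakDeriv_zero (n : ℕ) : weakDeriv^[n] 0 = 0 :=
  Function.iterate_fixed weakDeriv_zero n

lemma exists_continuousRep {f : L2} (hf : f ∈ sobolev 1) : ∃ u, IsContinuousRep f u := by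
  obtain ⟨g, -, h⟩ := hf
  obtain ⟨c, hc⟩ := h.exists_continuous
  have hi : IntervalIntegrable g volume 0 1 := by
    rw [intervalIntegrable_iff_integrableOn_Ioo_of_le zero_le_one]; exact integrable_coe g
  refine ⟨_, continuousOn_const.add ?_, hc⟩
  have := intervalIntegral.continuousOn_primitive_interval' hi (a := 0) (by simp)
  rwa [uIcc_of_le zero_le_one] at this

lemma pointValue_add {f g : L2} (hf : f ∈ sobolev 1) (hg : g ∈ sobolev 1) {p : ℝ}
    (hp : p ∈ Icc (0 : ℝ) 1) : pointValue (f + g) p = pointValue f p + pointValue g p := by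
  obtain ⟨u, hu⟩ := exists_continuousRep hf
  obtain ⟨v, hv⟩ := exists_continuousRep hg
  have : IsContinuousRep (f + g) (u + v) :=
    ⟨hu.1.add hv.1, (Lp.coeFn_add f g).trans (hu.2.add hv.2)⟩
  rw [this.pointValue_eq hp, hu.pointValue_eq hp, hv.pointValue_eq hp, Pi.add_apply]

lemma pointValue_smul (c : ℂ) {f : L2} (hf : f ∈ sobolev 1) {p : ℝ}
    (hp : p ∈ Icc (0 : ℝ) 1) : pointValue (c • f) p = c * pointValue f p := by
  obtain ⟨u, hu⟩ := exists_continuousRep hf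
  have : IsContinuousRep (c • f) (c • u) :=
    ⟨hu.1.const_smul c, (Lp.coeFn_smul c f).trans (hu.2.const_smul c)⟩
  rw [this.pointValue_eq hp, hu.pointValue_eq hp, Pi.smul_apply, smul_eq_mul]

lemma zero_mem_unit : (0 : ℝ) ∈ Icc (0 : ℝ) 1 := ⟨le_rfl, zero_le_one⟩

lemma one_mem_unit : (1 : ℝ) ∈ Icc (0 : ℝ) 1 := ⟨zero_le_one, le_rfl⟩

lemma pointValue_zero {p : ℝ} (hp : p ∈ Icc (0 : ℝ) 1) : pointValue 0 p = 0 := by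
  have := pointValue_smul 0 (zero_mem (sobolev 1)) hp
  simpa using this

/-- A class in `H¹(0,1)` with zero weak derivative and zero value at `1` vanishes. -/
lemma eq_zero_of_weakDeriv_eq_zero {f : L2} (hf : f ∈ sobolev 1) (hd : weakDeriv f = 0)
    (h1 : pointValue f 1 = 0) : f = 0 := by
  have h := hasWeakDeriv_of_mem hf
  rw [hd] at h
  obtain ⟨c, hc⟩ := ae_const_of_integral_deriv_smul_eq_zero (integrable_coe f) (by
    intro φ hφ
    rw [h φ hφ, integral_eq_zero_of_ae, neg_zero]
    filter_upwards [Lp.coeFn_zero ℂ 2 unitMeasure] with s hs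
    rw [hs]; simp)
  have hr : IsContinuousRep f (fun _ => c) := ⟨continuousOn_const, hc⟩
  rw [hr.pointValue_eq one_mem_unit] at h1
  subst h1
  exact Lp.ext (hc.trans (Lp.coeFn_zero ℂ 2 unitMeasure).symm)

/-- `Hᵐ_*(0,1) = {w ∈ Hᵐ(0,1) : w(1) = 0}`, for `m ≥ 1`. -/
def sobolevStar (m : ℕ) : Submodule ℂ L2 where
  carrier := {w | w ∈ sobolev m ∧ w ∈ sobolev 1 ∧ pointValue w 1 = 0}
  add_mem' := fun ⟨h, h', h''⟩ ⟨k, k', k''⟩ => ⟨add_mem h k, add_mem h' k', by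
    rw [pointValue_add h' k' one_mem_unit, h'', k'', add_zero]⟩
  zero_mem' := ⟨zero_mem _, zero_mem _, pointValue_zero one_mem_unit⟩
  smul_mem' := fun c _ ⟨h, h', h''⟩ => ⟨Submodule.smul_mem _ c h, Submodule.smul_mem _ c h', by
    rw [pointValue_smul c h' one_mem_unit, h'', mul_zero]⟩

/-- `H²_*(𝐆)`: triples in `H²_*(0,1)` which are continuous at the inner vertex `s = 0`. -/
def H2StarG : Submodule ℂ (Fin 3 → L2) where
  carrier := {w | (∀ k, w k ∈ sobolevStar 2) ∧ ∀ j k, pointValue (w j) 0 = pointValue (w k) 0}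
  add_mem' := fun {u w} ⟨h, h'⟩ ⟨k, k'⟩ => ⟨fun i => add_mem (h i) (k i), fun i j => by
    simp only [Pi.add_apply]
    rw [pointValue_add (h i).2.1 (k i).2.1 zero_mem_unit,
      pointValue_add (h j).2.1 (k j).2.1 zero_mem_unit, h' i j, k' i j]⟩
  zero_mem' := ⟨fun _ => zero_mem _, fun _ _ => rfl⟩
  smul_mem' := fun c w ⟨h, h'⟩ => ⟨fun i => Submodule.smul_mem _ c (h i), fun i j => by
    simp only [Pi.smul_apply]
    rw [pointValue_smul c (h i).2.1 zero_mem_unit,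
      pointValue_smul c (h j).2.1 zero_mem_unit, h' i j]⟩

/-! ### The state space and the operators -/

/-- The parameters of the network, with the standing restrictions on them. -/
structure Params where
  α : ℝ
  β : ℝ
  γ : ℝ
  η : ℝ
  κ : ℝ
  α_nonneg : 0 ≤ α
  κ_nonneg : 0 ≤ κ
  β_pos : 0 < β
  β_lt_one : β < 1
  γ_pos : 0 < γ
  η_nonneg : 0 ≤ η
  sq_η_lt_γ : η ^ 2 < γ

/-- The state space `𝒳 = H²_*(𝐆) × L₂(𝐆)` of pairs `(w, v)`, `w = (w₁,w₂,w₃)`, `v = (v₁,v₂,v₃)`.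
It depends on the parameters through its inner product, which is defined below. -/
def StateSpace (_P : Params) : Type := ↥(H2StarG.prod (⊤ : Submodule ℂ (Fin 3 → L2)))

namespace StateSpace

variable {P : Params}

instance : AddCommGroup (StateSpace P) :=
  inferInstanceAs (AddCommGroup ↥(H2StarG.prod (⊤ : Submodule ℂ (Fin 3 → L2))))

instance : Module ℂ (StateSpace P) :=
  inferInstanceAs (Module ℂ ↥(H2StarG.prod (⊤ : Submodule ℂ (Fin 3 → L2))))

/-- The displacement component `w` of a state. -/
def w (x : StateSpace P) : Fin 3 → L2 := x.1.1

/-- The velocity component `v` of a state. -/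
def v (x : StateSpace P) : Fin 3 → L2 := x.1.2

/-- The state with components `w` and `v`. -/
def mk (w v : Fin 3 → L2) (hw : w ∈ H2StarG) : StateSpace P := ⟨(w, v), hw, Submodule.mem_top⟩

lemma ext {x y : StateSpace P} (hw : x.w = y.w) (hv : x.v = y.v) : x = y :=
  Subtype.ext (Prod.ext hw hv)

@[simp] lemma w_mk (w v : Fin 3 → L2) (hw : w ∈ H2StarG) : (mk w v hw : StateSpace P).w = w := rfl
@[simp] lemma v_mk (w v : Fin 3 → L2) (hw : w ∈ H2StarG) : (mk w v hw : StateSpace P).v = v := rfl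
@[simp] lemma w_add (x y : StateSpace P) : (x + y).w = x.w + y.w := rfl
@[simp] lemma v_add (x y : StateSpace P) : (x + y).v = x.v + y.v := rfl
@[simp] lemma w_smul (c : ℂ) (x : StateSpace P) : (c • x).w = c • x.w := rfl
@[simp] lemma v_smul (c : ℂ) (x : StateSpace P) : (c • x).v = c • x.v := rfl
@[simp] lemma w_zero : (0 : StateSpace P).w = 0 := rfl
@[simp] lemma v_zero : (0 : StateSpace P).v = 0 := rfl

lemma w_mem (x : StateSpace P) : x.w ∈ H2StarG := x.2.1

lemma w_mem_sobolev_two (x : StateSpace P) (k : Fin 3) : x.w k ∈ sobolev 2 := (x.w_mem.1 k).1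

lemma w_mem_sobolev_one (x : StateSpace P) (k : Fin 3) : x.w k ∈ sobolev 1 := (x.w_mem.1 k).2.1

lemma weakDeriv_w_mem (x : StateSpace P) (k : Fin 3) : weakDeriv (x.w k) ∈ sobolev 1 :=
  weakDeriv_mem (x.w_mem_sobolev_two k)

/-- The energy inner product
`∑ₖ [∫ w̃ₖ'' conj wₖ'' + (γ - η²) ∫ w̃ₖ' conj wₖ' + α w̃ₖ'(0) conj wₖ'(0)] + ∑ₖ ∫ ṽₖ conj vₖ`
(conjugate-linear in the first variable, as is the convention for `inner`). -/
instance : Inner ℂ (StateSpace P) where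
  inner x y :=
    ∑ k, (inner ℂ (weakDeriv^[2] (x.w k)) (weakDeriv^[2] (y.w k))
        + ((P.γ - P.η ^ 2 : ℝ) : ℂ) * inner ℂ (weakDeriv (x.w k)) (weakDeriv (y.w k))
        + (P.α : ℂ) * (pointValue (weakDeriv (y.w k)) 0
            * (starRingEnd ℂ) (pointValue (weakDeriv (x.w k)) 0)))
      + ∑ k, inner ℂ (x.v k) (y.v k)

lemma inner_def (x y : StateSpace P) : inner ℂ x y =
    ∑ k, (inner ℂ (weakDeriv^[2] (x.w k)) (weakDeriv^[2] (y.w k))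
        + ((P.γ - P.η ^ 2 : ℝ) : ℂ) * inner ℂ (weakDeriv (x.w k)) (weakDeriv (y.w k))
        + (P.α : ℂ) * (pointValue (weakDeriv (y.w k)) 0
            * (starRingEnd ℂ) (pointValue (weakDeriv (x.w k)) 0)))
      + ∑ k, inner ℂ (x.v k) (y.v k) := rfl

lemma inner_self (x : StateSpace P) : inner ℂ x x =
    ((∑ k, (‖weakDeriv^[2] (x.w k)‖ ^ 2 + (P.γ - P.η ^ 2) * ‖weakDeriv (x.w k)‖ ^ 2
        + P.α * ‖pointValue (weakDeriv (x.w k)) 0‖ ^ 2) + ∑ k, ‖x.v k‖ ^ 2 : ℝ) : ℂ) := by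
  rw [inner_def]
  push_cast
  simp only [inner_self_eq_norm_sq_to_K, Complex.mul_conj, Complex.normSq_eq_norm_sq]
  push_cast
  rfl

/-- `inner` satisfies the axioms of an inner product. -/
@[reducible] def innerCore : InnerProductSpace.Core ℂ (StateSpace P) where
  conj_inner_symm x y := by
    simp only [inner_def, map_add, map_sum, map_mul, inner_conj_symm, Complex.conj_ofReal,
      Complex.conj_conj]
    congr 1
    refine Finset.sum_congr rfl fun k _ => ?_
    ring
  re_inner_nonneg x := by
    rw [inner_self, RCLike.re_to_complex, Complex.ofReal_re]
    have h1 := P.sq_η_lt_γ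
    have h2 := P.α_nonneg
    have h3 : 0 ≤ P.γ - P.η ^ 2 := by linarith
    positivity
  add_left x y z := by
    simp only [inner_def, w_add, v_add, Pi.add_apply]
    simp only [iterate_weakDeriv_add 2 (x.w_mem_sobolev_two _) (y.w_mem_sobolev_two _),
      weakDeriv_add (x.w_mem_sobolev_one _) (y.w_mem_sobolev_one _),
      pointValue_add (x.weakDeriv_w_mem _) (y.weakDeriv_w_mem _) zero_mem_unit,
      inner_add_left, map_add, Finset.sum_add_distrib, mul_add]
    ring
  smul_left x y c := by
    simp only [inner_def, w_smul, v_smul, Pi.smul_apply]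
    simp only [iterate_weakDeriv_smul 2 c (x.w_mem_sobolev_two _),
      weakDeriv_smul c (x.w_mem_sobolev_one _),
      pointValue_smul c (x.weakDeriv_w_mem _) zero_mem_unit,
      inner_smul_left, map_mul, mul_add, Finset.mul_sum]
    congr 1
    refine Finset.sum_congr rfl fun k _ => ?_
    ring
  definite x h := by
    rw [inner_self] at h
    have h := Complex.ofReal_eq_zero.1 h
    have h1 : 0 < P.γ - P.η ^ 2 := sub_pos.2 P.sq_η_lt_γ
    have h2 := P.α_nonneg
    have n1 : ∀ k ∈ Finset.univ, 0 ≤ ‖weakDeriv^[2] (x.w k)‖ ^ 2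
        + (P.γ - P.η ^ 2) * ‖weakDeriv (x.w k)‖ ^ 2
        + P.α * ‖pointValue (weakDeriv (x.w k)) 0‖ ^ 2 := fun k _ => by positivity
    have n2 : ∀ k ∈ (Finset.univ : Finset (Fin 3)), 0 ≤ ‖x.v k‖ ^ 2 := fun k _ => by positivity
    obtain ⟨e1, e2⟩ := (add_eq_zero_iff_of_nonneg (Finset.sum_nonneg n1)
      (Finset.sum_nonneg n2)).1 h
    rw [Finset.sum_eq_zero_iff_of_nonneg n1] at e1
    rw [Finset.sum_eq_zero_iff_of_nonneg n2] at e2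
    refine ext (funext fun k => ?_) (funext fun k => ?_)
    · refine eq_zero_of_weakDeriv_eq_zero (x.w_mem_sobolev_one k) ?_ (x.w_mem.1 k).2.2
      have e := e1 k (Finset.mem_univ k)
      have a1 : 0 ≤ ‖weakDeriv^[2] (x.w k)‖ ^ 2 := by positivity
      have a2 : 0 ≤ (P.γ - P.η ^ 2) * ‖weakDeriv (x.w k)‖ ^ 2 := by positivity
      have a3 : 0 ≤ P.α * ‖pointValue (weakDeriv (x.w k)) 0‖ ^ 2 := by positivity
      have a4 : (P.γ - P.η ^ 2) * ‖weakDeriv (x.w k)‖ ^ 2 = 0 := by linarith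
      have a5 := (mul_eq_zero.1 a4).resolve_left h1.ne'
      exact norm_eq_zero.1 (pow_eq_zero_iff two_ne_zero |>.1 a5)
    · exact norm_eq_zero.1 (pow_eq_zero_iff two_ne_zero |>.1 (e2 k (Finset.mem_univ k)))

instance : NormedAddCommGroup (StateSpace P) := (innerCore (P := P)).toNormedAddCommGroup

instance : InnerProductSpace ℂ (StateSpace P) := InnerProductSpace.ofCore innerCore.toCore

end StateSpace

open StateSpace

/-- The operator `𝒜 (w, v) = (v, -w⁗ + (γ - η²) w'')`. Its domain consists of the states with
`wₖ ∈ H⁴(0,1)`, `v ∈ H²_*(𝐆)`, `wₖ''(1) = 0`, `wₖ''(0) - α wₖ'(0) - κ vₖ'(0) = 0`, and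
`∑ₖ [wₖ'''(0) - (γ - η²) wₖ'(0) + βη vₖ(0)] = 0`. The continuity `vⱼ(0) = vₖ(0)` contained in
`v ∈ H²_*(𝐆)` is what makes `𝒜 (w, v)` an element of the state space. -/
def opA (P : Params) : StateSpace P →ₗ.[ℂ] StateSpace P where
  domain :=
    { carrier := {x |
        (∀ k, x.w k ∈ sobolev 4) ∧ x.v ∈ H2StarG ∧
        (∀ k, pointValue (weakDeriv^[2] (x.w k)) 1 = 0) ∧
        (∀ k, pointValue (weakDeriv^[2] (x.w k)) 0 - P.α * pointValue (weakDeriv (x.w k)) 0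
          - P.κ * pointValue (weakDeriv (x.v k)) 0 = 0) ∧
        ∑ k, (pointValue (weakDeriv^[3] (x.w k)) 0
          - (P.γ - P.η ^ 2) * pointValue (weakDeriv (x.w k)) 0
          + P.β * P.η * pointValue (x.v k) 0) = 0}
      add_mem' := by
        rintro x y ⟨a1, a2, a3, a4, a5⟩ ⟨b1, b2, b3, b4, b5⟩
        have p2 : ∀ k, ∀ p ∈ Icc (0 : ℝ) 1, pointValue (weakDeriv^[2] (x.w k + y.w k)) p
            = pointValue (weakDeriv^[2] (x.w k)) p + pointValue (weakDeriv^[2] (y.w k)) p := by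
          intro k p hp
          rw [iterate_weakDeriv_add 2 (x.w_mem_sobolev_two k) (y.w_mem_sobolev_two k),
            pointValue_add (sobolev_antitone (by omega) (iterate_weakDeriv_mem 2 (m := 2) (a1 k)))
              (sobolev_antitone (by omega) (iterate_weakDeriv_mem 2 (m := 2) (b1 k))) hp]
        have p1 : ∀ k, pointValue (weakDeriv (x.w k + y.w k)) 0
            = pointValue (weakDeriv (x.w k)) 0 + pointValue (weakDeriv (y.w k)) 0 := by
          intro k
          rw [weakDeriv_add (x.w_mem_sobolev_one k) (y.w_mem_sobolev_one k),
            pointValue_add (x.weakDeriv_w_mem k) (y.weakDeriv_w_mem k) zero_mem_unit]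
        have q1 : ∀ k, pointValue (weakDeriv (x.v k + y.v k)) 0
            = pointValue (weakDeriv (x.v k)) 0 + pointValue (weakDeriv (y.v k)) 0 := by
          intro k
          rw [weakDeriv_add (a2.1 k).2.1 (b2.1 k).2.1,
            pointValue_add (weakDeriv_mem (a2.1 k).1) (weakDeriv_mem (b2.1 k).1) zero_mem_unit]
        have p3 : ∀ k, pointValue (weakDeriv^[3] (x.w k + y.w k)) 0
            = pointValue (weakDeriv^[3] (x.w k)) 0 + pointValue (weakDeriv^[3] (y.w k)) 0 := by
          intro k
          rw [iterate_weakDeriv_add 3 (sobolev_antitone (by omega) (a1 k))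
              (sobolev_antitone (by omega) (b1 k)),
            pointValue_add (iterate_weakDeriv_mem 3 (m := 1) (a1 k))
              (iterate_weakDeriv_mem 3 (m := 1) (b1 k)) zero_mem_unit]
        refine ⟨fun k => add_mem (a1 k) (b1 k), add_mem a2 b2, fun k => ?_, fun k => ?_, ?_⟩
        · rw [w_add, Pi.add_apply, p2 k 1 one_mem_unit, a3, b3, add_zero]
        · rw [w_add, v_add, Pi.add_apply, Pi.add_apply, p2 k 0 zero_mem_unit, p1, q1]
          linear_combination a4 k + b4 k
        · rw [← add_zero (0 : ℂ)]
          refine Eq.trans ?_ (congrArg₂ (· + ·) a5 b5)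
          rw [← Finset.sum_add_distrib]
          refine Finset.sum_congr rfl fun k _ => ?_
          rw [w_add, v_add, Pi.add_apply, Pi.add_apply, p1, p3,
            pointValue_add (a2.1 k).2.1 (b2.1 k).2.1 zero_mem_unit]
          ring
      zero_mem' := by
        refine ⟨fun k => zero_mem _, zero_mem _, fun k => ?_, fun k => ?_, ?_⟩ <;>
        simp [iterate_weakDeriv_zero, weakDeriv_zero, pointValue_zero zero_mem_unit,
          pointValue_zero one_mem_unit, -Function.iterate_succ]
      smul_mem' := by
        rintro c x ⟨a1, a2, a3, a4, a5⟩
        have p2 : ∀ k, ∀ p ∈ Icc (0 : ℝ) 1, pointValue (weakDeriv^[2] (c • x.w k)) p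
            = c * pointValue (weakDeriv^[2] (x.w k)) p := by
          intro k p hp
          rw [iterate_weakDeriv_smul 2 c (x.w_mem_sobolev_two k),
            pointValue_smul c (sobolev_antitone (by omega)
              (iterate_weakDeriv_mem 2 (m := 2) (a1 k))) hp]
        have p1 : ∀ k, pointValue (weakDeriv (c • x.w k)) 0
            = c * pointValue (weakDeriv (x.w k)) 0 := by
          intro k
          rw [weakDeriv_smul c (x.w_mem_sobolev_one k),
            pointValue_smul c (x.weakDeriv_w_mem k) zero_mem_unit]
        have q1 : ∀ k, pointValue (weakDeriv (c • x.v k)) 0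
            = c * pointValue (weakDeriv (x.v k)) 0 := by
          intro k
          rw [weakDeriv_smul c (a2.1 k).2.1,
            pointValue_smul c (weakDeriv_mem (a2.1 k).1) zero_mem_unit]
        have p3 : ∀ k, pointValue (weakDeriv^[3] (c • x.w k)) 0
            = c * pointValue (weakDeriv^[3] (x.w k)) 0 := by
          intro k
          rw [iterate_weakDeriv_smul 3 c (sobolev_antitone (by omega) (a1 k)),
            pointValue_smul c (iterate_weakDeriv_mem 3 (m := 1) (a1 k)) zero_mem_unit]
        refine ⟨fun k => Submodule.smul_mem _ c (a1 k), Submodule.smul_mem _ c a2,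
          fun k => ?_, fun k => ?_, ?_⟩
        · rw [w_smul, Pi.smul_apply, p2 k 1 one_mem_unit, a3, mul_zero]
        · rw [w_smul, v_smul, Pi.smul_apply, Pi.smul_apply, p2 k 0 zero_mem_unit, p1, q1]
          linear_combination c * a4 k
        · rw [← mul_zero c, ← a5, Finset.mul_sum]
          refine Finset.sum_congr rfl fun k _ => ?_
          rw [w_smul, v_smul, Pi.smul_apply, Pi.smul_apply, p1, p3,
            pointValue_smul c (a2.1 k).2.1 zero_mem_unit]
          ring }
  toFun :=
    { toFun := fun x => StateSpace.mk x.1.v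
        (fun k => -weakDeriv^[4] (x.1.w k)
          + ((P.γ - P.η ^ 2 : ℝ) : ℂ) • weakDeriv^[2] (x.1.w k)) x.2.2.1
      map_add' := by
        rintro ⟨x, a1, -⟩ ⟨y, b1, -⟩
        refine StateSpace.ext rfl (funext fun k => ?_)
        simp only [v_mk, v_add, Pi.add_apply, Submodule.coe_add, w_add]
        rw [iterate_weakDeriv_add 4 (a1 k) (b1 k),
          iterate_weakDeriv_add 2 (x.w_mem_sobolev_two k) (y.w_mem_sobolev_two k)]
        module
      map_smul' := by
        rintro c ⟨x, a1, -⟩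
        refine StateSpace.ext rfl (funext fun k => ?_)
        simp only [v_mk, v_smul, Pi.smul_apply, Submodule.coe_smul, w_smul, RingHom.id_apply]
        rw [iterate_weakDeriv_smul 4 c (a1 k),
          iterate_weakDeriv_smul 2 c (x.w_mem_sobolev_two k)]
        module }

/-- The operator `ℬ (w, v) = (0, -2βη v')`, with the `vₖ` in `H¹_*(0,1)`. -/
def opB (P : Params) : StateSpace P →ₗ.[ℂ] StateSpace P where
  domain :=
    { carrier := {x | ∀ k, x.v k ∈ sobolevStar 1}
      add_mem' := fun hx hy k => add_mem (hx k) (hy k)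
      zero_mem' := fun _ => zero_mem _
      smul_mem' := fun c _ hx k => Submodule.smul_mem _ c (hx k) }
  toFun :=
    { toFun := fun x => StateSpace.mk 0
        (fun k => ((-2 * P.β * P.η : ℝ) : ℂ) • weakDeriv (x.1.v k)) (zero_mem _)
      map_add' := by
        rintro ⟨x, hx⟩ ⟨y, hy⟩
        refine StateSpace.ext ?_ (funext fun k => ?_)
        · simp
        · simp only [v_mk, v_add, Pi.add_apply, Submodule.coe_add]
          rw [weakDeriv_add (hx k).2.1 (hy k).2.1, smul_add]
      map_smul' := by
        rintro c ⟨x, hx⟩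
        refine StateSpace.ext ?_ (funext fun k => ?_)
        · simp
        · simp only [v_mk, v_smul, Pi.smul_apply, Submodule.coe_smul, RingHom.id_apply]
          rw [weakDeriv_smul c (hx k).2.1, smul_comm] }

/-- The system operator `𝒯 = 𝒜 + ℬ`, on the intersection of the two domains. -/
def opT (P : Params) : StateSpace P →ₗ.[ℂ] StateSpace P := opA P + opB P

/-- `𝒟(𝒯) = 𝒟(𝒜)`. -/
lemma opT_domain (P : Params) : (opT P).domain = (opA P).domain := by
  refine inf_eq_left.2 fun x hx k => ?_
  exact ⟨(hx.2.1.1 k).2.1, (hx.2.1.1 k).2.1, (hx.2.1.1 k).2.2⟩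

lemma opT_apply_w (P : Params) (x : (opT P).domain) : (opT P x).w = x.1.v := by
  have h : opT P x = opA P ⟨x.1, x.2.1⟩ + opB P ⟨x.1, x.2.2⟩ := rfl
  rw [h, w_add]
  exact add_zero x.1.v

lemma opT_apply_v (P : Params) (x : (opT P).domain) (k : Fin 3) : (opT P x).v k =
    -weakDeriv^[4] (x.1.w k) + ((P.γ - P.η ^ 2 : ℝ) : ℂ) • weakDeriv^[2] (x.1.w k)
      + ((-2 * P.β * P.η : ℝ) : ℂ) • weakDeriv (x.1.v k) := rfl

/-! ### Semigroups and solutions -/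

section Semigroup

variable {X : Type*} [NormedAddCommGroup X] [NormedSpace ℂ X]

/-- `S`, restricted to `[0,∞)`, is a `C₀`-semigroup of bounded operators on `X`. -/
structure IsC0Semigroup (S : ℝ → X →L[ℂ] X) : Prop where
  map_zero : S 0 = ContinuousLinearMap.id ℂ X
  map_add : ∀ s t : ℝ, 0 ≤ s → 0 ≤ t → S (s + t) = (S s).comp (S t)
  tendsto_zero : ∀ x : X, Tendsto (fun t => S t x) (𝓝[>] 0) (𝓝 x)

/-- `T` is the infinitesimal generator of `S`: `x ∈ 𝒟(T)` and `T x = y` if and only if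
`(S(t)x - x)/t → y` as `t ↓ 0`. -/
def IsGenerator (S : ℝ → X →L[ℂ] X) (T : X →ₗ.[ℂ] X) : Prop :=
  ∀ x y : X, (x, y) ∈ T.graph ↔
    Tendsto (fun t : ℝ => t⁻¹ • (S t x - x)) (𝓝[>] 0) (𝓝 y)

/-- `x`, restricted to `[0,∞)`, is a solution of `ẋ(t) = T x(t)`, `x(0) = x₀`, in the class
`C¹((0,∞); X) ∩ C([0,∞); 𝒟(T))`, where `𝒟(T)` carries the graph norm. -/
structure IsSolution (T : X →ₗ.[ℂ] X) (x₀ : X) (x : ℝ → X) : Prop where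
  initial : x 0 = x₀
  mem_domain : ∀ t : ℝ, 0 ≤ t → x t ∈ T.domain
  continuousOn : ContinuousOn x (Ici 0)
  continuousOn_apply :
    Continuous fun t : Ici (0 : ℝ) => T ⟨x t, mem_domain t t.2⟩
  contDiffOn : ContDiffOn ℝ 1 x (Ioi 0)
  hasDerivAt : ∀ (t : ℝ) (ht : 0 < t), HasDerivAt x (T ⟨x t, mem_domain t ht.le⟩) t

end Semigroup

end PipeNetwork

end

/-!
Pairing the equation `𝒯 x = y` with a state `φ` in the energy inner product and integrating by parts
moves all derivatives and traces from `x` onto `y` and `φ`, and the Riesz representation of the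
resulting bounded form defines a bounded operator `K` on the state space with `K (𝒯 x) = x`. The
choice `φ = y` gives `Re ⟪K y, y⟫ = -κ ∑ₖ |wₖ'(0)|² ≤ 0`, where `w` is the displacement of `y`: the
gyroscopic term integrates to a boundary term that cancels the coupling at the junction. Conversely
`K y` is a weak solution of a fourth order equation; by the du Bois-Reymond lemma it is regular, and
the natural boundary conditions place it in `𝒟(𝒯)`, so `K = 𝒯⁻¹`.

On a Hilbert space, a bounded injective dissipative operator `K` has dense range, and `K⁻¹`
generates a contraction semigroup, the strong limit of the exponentials of `t (K - ε)⁻¹` as `ε ↓ 0`.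
-/

noncomputable section

namespace PipeNetwork

/-! ### Integration by parts on the unit interval -/

lemma integral_setIntegral_Iic_mul_add_setIntegral_Iio_mul {𝕜 : Type*} [RCLike 𝕜]
    {μ : Measure ℝ} [SFinite μ] {g h : ℝ → 𝕜} (hg : Integrable g μ) (hh : Integrable h μ) :
    ∫ s, (∫ r in Iic s, g r ∂μ) * h s ∂μ + ∫ s, (∫ r in Iio s, h r ∂μ) * g s ∂μ
      = (∫ s, g s ∂μ) * ∫ s, h s ∂μ := by
  have measurable_le : MeasurableSet {p : ℝ × ℝ | p.1 ≤ p.2} :=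
    measurableSet_le measurable_fst measurable_snd
  have integrable_prod : Integrable (fun p : ℝ × ℝ => g p.1 * h p.2) (μ.prod μ) := hg.mul_prod hh
  have lower_triangle : ∫ s, (∫ r in Iic s, g r ∂μ) * h s ∂μ
      = ∫ p in {p : ℝ × ℝ | p.1 ≤ p.2}, g p.1 * h p.2 ∂μ.prod μ := by
    rw [← integral_indicator measurable_le,
      integral_prod_symm _ (integrable_prod.indicator measurable_le)]
    simp only [← integral_mul_const, ← integral_indicator measurableSet_Iic, indicator,
      mem_Iic, mem_ofPred_eq, ite_mul, zero_mul]
  have upper_triangle : ∫ s, (∫ r in Iio s, h r ∂μ) * g s ∂μ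
      = ∫ p in {p : ℝ × ℝ | p.1 ≤ p.2}ᶜ, g p.1 * h p.2 ∂μ.prod μ := by
    rw [← integral_indicator measurable_le.compl,
      integral_prod _ (integrable_prod.indicator measurable_le.compl)]
    simp only [← integral_mul_const, ← integral_indicator measurableSet_Iio, indicator, mem_Iio,
      mem_compl_iff, mem_ofPred_eq, not_le, ite_mul, zero_mul, mul_comm (h _)]
  rw [lower_triangle, upper_triangle, integral_add_compl measurable_le integrable_prod,
    integral_prod_mul]

lemma setIntegral_Iic_unitMeasure {E : Type*} [NormedAddCommGroup E] [NormedSpace ℝ E]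
    (g : ℝ → E) {s : ℝ} (hs : s ∈ Icc (0 : ℝ) 1) :
    ∫ r in Iic s, g r ∂unitMeasure = ∫ r in (0 : ℝ)..s, g r := by
  rw [intervalIntegral.integral_of_le hs.1, unitMeasure, restrict_Ioo_eq_restrict_Ioc,
    Measure.restrict_restrict measurableSet_Iic, inter_comm, Ioc_inter_Iic, min_eq_right hs.2]

lemma integral_unitMeasure {E : Type*} [NormedAddCommGroup E] [NormedSpace ℝ E] (g : ℝ → E) :
    ∫ s, g s ∂unitMeasure = ∫ s in (0 : ℝ)..1, g s := by
  rw [intervalIntegral.integral_of_le zero_le_one, integral_Ioc_eq_integral_Ioo]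

lemma intervalIntegrable_of_unitMeasure {E : Type*} [NormedAddCommGroup E] {g : ℝ → E}
    (hg : Integrable g unitMeasure) : IntervalIntegrable g volume 0 1 :=
  (intervalIntegrable_iff_integrableOn_Ioo_of_le zero_le_one).2 hg

lemma continuousOn_primitive {E : Type*} [NormedAddCommGroup E] [NormedSpace ℝ E] {g : ℝ → E}
    (hg : Integrable g unitMeasure) (c : E) :
    ContinuousOn (fun t => c + ∫ r in (0 : ℝ)..t, g r) (Icc 0 1) := by
  have := intervalIntegral.continuousOn_primitive_interval' (intervalIntegrable_of_unitMeasure hg)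
    left_mem_uIcc
  rw [uIcc_of_le zero_le_one] at this
  exact continuousOn_const.add this

lemma integral_primitive_mul_add_integral_primitive_mul {𝕜 : Type*} [RCLike 𝕜] {g h : ℝ → 𝕜}
    (hg : Integrable g unitMeasure) (hh : Integrable h unitMeasure) (c d : 𝕜) :
    ∫ s, (c + ∫ r in (0 : ℝ)..s, g r) * h s ∂unitMeasure
        + ∫ s, (d + ∫ r in (0 : ℝ)..s, h r) * g s ∂unitMeasure
      = (c + ∫ r in (0 : ℝ)..1, g r) * (d + ∫ r in (0 : ℝ)..1, h r) - c * d := by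
  have integral_add_mul {k l : ℝ → 𝕜} (hk : Integrable k unitMeasure)
      (hl : Integrable l unitMeasure) (b : 𝕜) :
      ∫ s, (b + ∫ r in (0 : ℝ)..s, k r) * l s ∂unitMeasure
        = b * ∫ s, l s ∂unitMeasure
          + ∫ s, (∫ r in Iic s, k r ∂unitMeasure) * l s ∂unitMeasure := by
    have integrable_mul : Integrable (fun s => (∫ r in (0 : ℝ)..s, k r) * l s) unitMeasure :=
      (intervalIntegrable_iff_integrableOn_Ioo_of_le zero_le_one).1
        ((intervalIntegrable_of_unitMeasure hl).continuousOn_mul (by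
          simpa only [uIcc_of_le zero_le_one, zero_add] using continuousOn_primitive hk 0))
    have restrict_eq : ∫ s, (∫ r in Iic s, k r ∂unitMeasure) * l s ∂unitMeasure
        = ∫ s, (∫ r in (0 : ℝ)..s, k r) * l s ∂unitMeasure :=
      setIntegral_congr_fun measurableSet_Ioo fun s hs => by
        simp only [setIntegral_Iic_unitMeasure k (Ioo_subset_Icc_self hs)]
    rw [restrict_eq, ← integral_const_mul, ← integral_add (hl.const_mul b) integrable_mul]
    simp only [add_mul]
  have triangles := integral_setIntegral_Iic_mul_add_setIntegral_Iio_mul hg hh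
  simp only [integral_Iic_eq_integral_Iio.symm] at triangles
  rw [integral_add_mul hg hh, integral_add_mul hh hg, ← integral_unitMeasure g,
    ← integral_unitMeasure h]
  linear_combination triangles

/-! ### Primitives of square integrable classes -/

instance : IsProbabilityMeasure unitMeasure := ⟨by simp [unitMeasure]⟩

lemma memLp_of_continuousOn_Icc {u : ℝ → ℂ} (hu : ContinuousOn u (Icc 0 1)) :
    MemLp u 2 unitMeasure := by
  obtain ⟨C, hC⟩ := isCompact_Icc.exists_bound_of_continuousOn hu
  refine MemLp.of_bound ((hu.mono Ioo_subset_Icc_self).aestronglyMeasurable measurableSet_Ioo) C ?_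
  filter_upwards [ae_restrict_mem measurableSet_Ioo] with s hs
  exact hC s (Ioo_subset_Icc_self hs)

lemma HasWeakDeriv.ae_eq_primitive {f g : L2} (h : HasWeakDeriv f g) :
    f =ᵐ[unitMeasure] fun t => pointValue f 0 + ∫ r in (0 : ℝ)..t, g r := by
  obtain ⟨c, hc⟩ := h.exists_continuous
  have hf : IsContinuousRep f _ := ⟨continuousOn_primitive (integrable_coe g) c, hc⟩
  have value_zero := hf.pointValue_eq zero_mem_unit
  rw [intervalIntegral.integral_same, add_zero] at value_zero
  rwa [value_zero]

lemma HasWeakDeriv.pointValue_eq {f g : L2} (h : HasWeakDeriv f g) {p : ℝ}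
    (hp : p ∈ Icc (0 : ℝ) 1) :
    pointValue f p = pointValue f 0 + ∫ r in (0 : ℝ)..p, g r :=
  IsContinuousRep.pointValue_eq
    ⟨continuousOn_primitive (integrable_coe g) _, h.ae_eq_primitive⟩ hp

lemma IsTestFunction.apply_eq_zero {φ : ℝ → ℝ} (hφ : IsTestFunction φ) {s : ℝ}
    (hs : s ∉ Ioo (0 : ℝ) 1) : φ s = 0 :=
  image_eq_zero_of_notMem_tsupport fun h => hs (hφ.tsupport_subset h)

lemma IsTestFunction.integral_deriv {φ : ℝ → ℝ} (hφ : IsTestFunction φ) (s : ℝ) :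
    ∫ r in (0 : ℝ)..s, ((_root_.deriv φ r : ℝ) : ℂ) = φ s := by
  rw [intervalIntegral.integral_ofReal, intervalIntegral.integral_deriv_eq_sub
    (fun x _ => (hφ.contDiff.differentiable (by simp)).differentiableAt)
    (hφ.deriv.contDiff.continuous.intervalIntegrable _ _),
    hφ.apply_eq_zero (s := 0) (by simp), sub_zero]

lemma hasWeakDeriv_of_ae_eq_primitive {f g : L2} {c : ℂ}
    (h : f =ᵐ[unitMeasure] fun t => c + ∫ r in (0 : ℝ)..t, g r) : HasWeakDeriv f g := by
  intro φ hφ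
  have integrable_deriv : Integrable (fun s => ((deriv φ s : ℝ) : ℂ)) unitMeasure :=
    ((Complex.continuous_ofReal.comp hφ.deriv.contDiff.continuous).integrableOn_Icc
      (a := 0) (b := 1)).mono_set Ioo_subset_Icc_self
  have by_parts := integral_primitive_mul_add_integral_primitive_mul (integrable_coe g)
    integrable_deriv c 0
  simp only [hφ.integral_deriv, hφ.apply_eq_zero (s := 1) (by simp), Complex.ofReal_zero, add_zero,
    mul_zero, zero_add, sub_zero] at by_parts
  rw [← add_eq_zero_iff_eq_neg, ← by_parts]
  congr 1
  refine integral_congr_ae ?_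
  filter_upwards [h] with s hs
  rw [hs, Complex.real_smul, mul_comm]

/-- The class of the primitive `t ↦ c + ∫₀ᵗ g` of `g`. -/
def primitive (g : L2) (c : ℂ) : L2 :=
  (memLp_of_continuousOn_Icc (continuousOn_primitive (integrable_coe g) c)).toLp _

lemma coeFn_primitive (g : L2) (c : ℂ) :
    primitive g c =ᵐ[unitMeasure] fun t => c + ∫ r in (0 : ℝ)..t, g r :=
  MemLp.coeFn_toLp _

lemma hasWeakDeriv_primitive (g : L2) (c : ℂ) : HasWeakDeriv (primitive g c) g :=
  hasWeakDeriv_of_ae_eq_primitive (coeFn_primitive g c)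

lemma pointValue_primitive_zero (g : L2) (c : ℂ) : pointValue (primitive g c) 0 = c := by
  simpa using IsContinuousRep.pointValue_eq
    ⟨continuousOn_primitive (integrable_coe g) c, coeFn_primitive g c⟩ zero_mem_unit

lemma HasWeakDeriv.inner_add_inner {f f' g g' : L2} (hf : HasWeakDeriv f f')
    (hg : HasWeakDeriv g g') :
    inner ℂ f g' + inner ℂ f' g = starRingEnd ℂ (pointValue f 1) * pointValue g 1
      - starRingEnd ℂ (pointValue f 0) * pointValue g 0 := by
  have integrable_conj : Integrable (fun s => starRingEnd ℂ (f' s)) unitMeasure :=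
    Complex.conjCLE.toContinuousLinearMap.integrable_comp (integrable_coe f')
  have integral_conj (s : ℝ) : ∫ r in (0 : ℝ)..s, starRingEnd ℂ (f' r)
      = starRingEnd ℂ (∫ r in (0 : ℝ)..s, f' r) := by
    simp only [intervalIntegral, _root_.integral_conj, map_sub]
  have by_parts := integral_primitive_mul_add_integral_primitive_mul integrable_conj
    (integrable_coe g') (starRingEnd ℂ (pointValue f 0)) (pointValue g 0)
  simp only [integral_conj, ← map_add] at by_parts
  rw [← hf.pointValue_eq one_mem_unit, ← hg.pointValue_eq one_mem_unit] at by_parts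
  rw [← by_parts, L2.inner_def, L2.inner_def]
  congr 1 <;> refine integral_congr_ae ?_
  · filter_upwards [hf.ae_eq_primitive] with s hs
    rw [RCLike.inner_apply, ← hs, mul_comm]
  · filter_upwards [hg.ae_eq_primitive] with s hs
    rw [RCLike.inner_apply, ← hs]

lemma norm_intervalIntegral_coe_le (g : L2) {a b : ℝ} (ha : 0 ≤ a) (hab : a ≤ b) (hb : b ≤ 1) :
    ‖∫ r in a..b, g r‖ ≤ ‖g‖ := by
  calc ‖∫ r in a..b, g r‖
      ≤ ∫ r in a..b, ‖g r‖ := intervalIntegral.norm_integral_le_integral_norm hab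
    _ ≤ ∫ r in (0 : ℝ)..1, ‖g r‖ :=
        intervalIntegral.integral_mono_interval ha hab hb (Eventually.of_forall fun _ =>
          norm_nonneg _) (intervalIntegrable_of_unitMeasure (integrable_coe g).norm)
    _ = (eLpNorm g 1 unitMeasure).toReal := by
        rw [← integral_unitMeasure, integral_norm_eq_lintegral_enorm (Lp.aestronglyMeasurable g),
          eLpNorm_one_eq_lintegral_enorm]
    _ ≤ ‖g‖ := ENNReal.toReal_mono (Lp.eLpNorm_ne_top g)
        (eLpNorm_le_eLpNorm_of_exponent_le one_le_two (Lp.aestronglyMeasurable g))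

lemma HasWeakDeriv.norm_le {f g : L2} (h : HasWeakDeriv f g) (h1 : pointValue f 1 = 0) :
    ‖f‖ ≤ ‖g‖ := by
  have hi := intervalIntegrable_of_unitMeasure (integrable_coe g)
  have norm_le_ae : ∀ᵐ s ∂unitMeasure, ‖f s‖ ≤ ‖g‖ := by
    filter_upwards [h.ae_eq_primitive, ae_restrict_mem measurableSet_Ioo] with s hs hs01
    have value_one := h.pointValue_eq one_mem_unit
    rw [h1, ← intervalIntegral.integral_add_adjacent_intervals (b := s)
      (hi.mono_set (uIcc_subset_uIcc_left (by simp [uIcc_of_le, hs01.1.le, hs01.2.le])))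
      (hi.mono_set (uIcc_subset_uIcc_right (by simp [uIcc_of_le, hs01.1.le, hs01.2.le]))),
      ← add_assoc, ← hs] at value_one
    rw [eq_neg_of_add_eq_zero_left value_one.symm, norm_neg]
    exact norm_intervalIntegral_coe_le g hs01.1.le hs01.2.le le_rfl
  simpa [measureUnivNNReal] using Lp.norm_le_of_ae_bound (norm_nonneg g) norm_le_ae

lemma IsTestFunction.continuous_integral_smul {φ : ℝ → ℝ} (hφ : IsTestFunction φ) :
    Continuous fun f : L2 => ∫ s in Ioo (0 : ℝ) 1, φ s • f s := by
  have memLp : MemLp (fun s => (φ s : ℂ)) 2 unitMeasure := memLp_of_continuousOn_Icc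
    (Complex.continuous_ofReal.comp hφ.contDiff.continuous).continuousOn
  have eq_inner : (fun f : L2 => ∫ s in Ioo (0 : ℝ) 1, φ s • f s)
      = fun f => inner ℂ (memLp.toLp _) f := by
    funext f
    rw [L2.inner_def]
    refine integral_congr_ae ?_
    filter_upwards [memLp.coeFn_toLp] with s hs
    rw [hs, RCLike.inner_apply, Complex.conj_ofReal, Complex.real_smul, mul_comm]
  rw [eq_inner]
  exact continuous_const.inner continuous_id

lemma isClosed_setOf_hasWeakDeriv : IsClosed {p : L2 × L2 | HasWeakDeriv p.1 p.2} := by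
  simp only [HasWeakDeriv, ofPred_forall]
  exact isClosed_iInter fun φ => isClosed_iInter fun hφ => isClosed_eq
    (hφ.deriv.continuous_integral_smul.comp continuous_fst)
    (hφ.continuous_integral_smul.comp continuous_snd).neg

/-! ### The functions `1` and `1 - s` -/

/-- The class of the constant function `1`. -/
def one : L2 := Lp.const 2 unitMeasure 1

lemma isContinuousRep_one : IsContinuousRep one fun _ => 1 :=
  ⟨continuousOn_const, Lp.coeFn_const 2 unitMeasure 1⟩

protected lemma norm_one : ‖one‖ = 1 := by
  simp [one, Lp.norm_const]

lemma hasWeakDeriv_one : HasWeakDeriv one 0 := by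
  refine hasWeakDeriv_of_ae_eq_primitive (c := 1) ?_
  filter_upwards [isContinuousRep_one.2, ae_restrict_mem measurableSet_Ioo] with s hs hs01
  have integral_zero : ∫ r in (0 : ℝ)..s, (0 : L2) r = 0 := norm_le_zero_iff.1 <| by
    simpa only [norm_zero] using norm_intervalIntegral_coe_le 0 le_rfl hs01.1.le hs01.2.le
  rw [hs, integral_zero, add_zero]

lemma HasWeakDeriv.inner_one {f f' : L2} (h : HasWeakDeriv f f') :
    inner ℂ one f' = pointValue f 1 - pointValue f 0 := by
  have by_parts := hasWeakDeriv_one.inner_add_inner h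
  simpa only [inner_zero_left, add_zero, isContinuousRep_one.pointValue_eq one_mem_unit,
    isContinuousRep_one.pointValue_eq zero_mem_unit, map_one, one_mul] using by_parts

/-- The class of the function `s ↦ 1 - s`. -/
def ramp : L2 := primitive (-one) 1

lemma hasWeakDeriv_ramp : HasWeakDeriv ramp (-one) := hasWeakDeriv_primitive _ _

lemma pointValue_ramp_zero : pointValue ramp 0 = 1 := pointValue_primitive_zero _ _

lemma pointValue_ramp_one : pointValue ramp 1 = 0 := by
  have inner_neg_one := hasWeakDeriv_ramp.inner_one
  rw [inner_neg_right, inner_self_eq_norm_sq_to_K, PipeNetwork.norm_one,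
    pointValue_ramp_zero] at inner_neg_one
  simpa [eq_sub_iff_add_eq] using inner_neg_one.symm

lemma ramp_ne_zero : ramp ≠ 0 := fun h => by
  simpa [h, pointValue_zero zero_mem_unit] using pointValue_ramp_zero

lemma HasWeakDeriv.taylor {f f' f'' : L2} (hf : HasWeakDeriv f f') (hf' : HasWeakDeriv f' f'') :
    pointValue f 1 = pointValue f 0 + pointValue f' 0 + inner ℂ ramp f'' := by
  have by_parts := hasWeakDeriv_ramp.inner_add_inner hf'
  rw [inner_neg_left, hf.inner_one, pointValue_ramp_one, pointValue_ramp_zero, map_zero, zero_mul,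
    map_one, one_mul] at by_parts
  linear_combination -by_parts

/-! ### Weak solutions of `-w⁗ + δ w'' = G` on an edge -/

lemma exists_hasWeakDeriv_pointValue_one_eq_zero (g : L2) :
    ∃ f, HasWeakDeriv f g ∧ pointValue f 1 = 0 := by
  refine ⟨primitive g (-inner ℂ one g), hasWeakDeriv_primitive _ _, ?_⟩
  have value_sub := (hasWeakDeriv_primitive g (-inner ℂ one g)).inner_one
  rw [pointValue_primitive_zero] at value_sub
  linear_combination -value_sub

lemma mem_span_ramp_of_forall_inner_eq_zero {z : L2}
    (h : ∀ φ φ' φ'' : L2, HasWeakDeriv φ φ' → HasWeakDeriv φ' φ'' → pointValue φ 0 = 0 →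
      pointValue φ' 0 = 0 → pointValue φ 1 = 0 → inner ℂ φ'' z = 0) :
    z ∈ Submodule.span ℂ {ramp} := by
  rw [← (Submodule.span ℂ {ramp}).orthogonal_orthogonal, Submodule.mem_orthogonal]
  intro y hy
  have hφ := hasWeakDeriv_primitive (primitive y 0) 0
  have hφ' := hasWeakDeriv_primitive y 0
  refine h _ _ y hφ hφ' (pointValue_primitive_zero _ _) (pointValue_primitive_zero _ _) ?_
  rw [hφ.taylor hφ', pointValue_primitive_zero, pointValue_primitive_zero,
    Submodule.mem_orthogonal_singleton_iff_inner_right.1 hy, add_zero, add_zero]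

lemma exists_hasWeakDeriv_of_forall_inner_eq {u q : L2}
    (h : ∀ φ φ' φ'' : L2, HasWeakDeriv φ φ' → HasWeakDeriv φ' φ'' → pointValue φ 0 = 0 →
      pointValue φ' 0 = 0 → pointValue φ 1 = 0 → inner ℂ φ'' u = inner ℂ φ q) :
    ∃ u', HasWeakDeriv u u' ∧ HasWeakDeriv u' q ∧ pointValue u 1 = 0 := by
  have hr' : HasWeakDeriv (primitive q 0) q := hasWeakDeriv_primitive q 0
  obtain ⟨r, hr, r_one⟩ := exists_hasWeakDeriv_pointValue_one_eq_zero (primitive q 0)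
  obtain ⟨c, hc⟩ := Submodule.mem_span_singleton.1 <|
    mem_span_ramp_of_forall_inner_eq_zero (z := u - r)
      fun φ φ' φ'' hφ hφ' φ_zero φ'_zero φ_one => by
      have by_parts := hφ'.inner_add_inner hr
      have by_parts' := hφ.inner_add_inner hr'
      rw [r_one, φ'_zero, map_zero] at by_parts
      rw [φ_zero, φ_one, map_zero] at by_parts'
      rw [inner_sub_right, h φ φ' φ'' hφ hφ' φ_zero φ'_zero φ_one]
      linear_combination by_parts' - by_parts
  obtain rfl : u = r + c • ramp := by rw [hc, add_sub_cancel]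
  refine ⟨primitive q 0 + c • -one, hr.add (hasWeakDeriv_ramp.smul c), ?_, ?_⟩
  · simpa using hr'.add ((hasWeakDeriv_one.smul (-1)).smul c)
  · have ramp_mem : ramp ∈ sobolev 1 := ⟨_, trivial, hasWeakDeriv_ramp⟩
    rw [pointValue_add ⟨_, trivial, hr⟩ (Submodule.smul_mem _ c ramp_mem) one_mem_unit,
      pointValue_smul c ramp_mem one_mem_unit, pointValue_ramp_one, r_one, mul_zero, add_zero]

lemma hasWeakDeriv_iterate {m n : ℕ} {f : L2} (hf : f ∈ sobolev m) (h : n < m) :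
    HasWeakDeriv (weakDeriv^[n] f) (weakDeriv^[n + 1] f) := by
  rw [Function.iterate_succ_apply']
  exact hasWeakDeriv_of_mem (iterate_weakDeriv_mem n (m := 0 + 1)
    (sobolev_antitone (by omega) hf))

lemma HasWeakDeriv.iterate_two_eq {φ φ' φ'' : L2} (hφ : HasWeakDeriv φ φ')
    (hφ' : HasWeakDeriv φ' φ'') : weakDeriv^[2] φ = φ'' := by
  rw [Function.iterate_succ_apply, hφ.weakDeriv_eq, Function.iterate_one, hφ'.weakDeriv_eq]

lemma mem_sobolevStar_two {φ φ' φ'' : L2} (hφ : HasWeakDeriv φ φ') (hφ' : HasWeakDeriv φ' φ'')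
    (φ_one : pointValue φ 1 = 0) : φ ∈ sobolevStar 2 :=
  ⟨⟨φ', ⟨φ'', trivial, hφ'⟩, hφ⟩, ⟨φ', trivial, hφ⟩, φ_one⟩

lemma exists_mem_sobolevStar_two (a b : ℂ) :
    ∃ φ ∈ sobolevStar 2, pointValue φ 0 = a ∧ pointValue (weakDeriv φ) 0 = b := by
  let g : L2 := (-(a + b) / inner ℂ ramp ramp) • ramp
  have hφ := hasWeakDeriv_primitive (primitive g b) a
  have hφ' := hasWeakDeriv_primitive g b
  refine ⟨_, mem_sobolevStar_two hφ hφ' ?_, pointValue_primitive_zero _ _, ?_⟩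
  · rw [hφ.taylor hφ', pointValue_primitive_zero, pointValue_primitive_zero, inner_smul_right,
      div_mul_cancel₀ _ (inner_self_ne_zero.2 ramp_ne_zero)]
    ring
  · rw [hφ.weakDeriv_eq, pointValue_primitive_zero]

lemma greens_identity {u φ : L2} (hu : u ∈ sobolev 4) (hφ : φ ∈ sobolevStar 2)
    (hu1 : pointValue (weakDeriv^[2] u) 1 = 0) (δ : ℂ) :
    inner ℂ (weakDeriv^[2] φ) (weakDeriv^[2] u) + δ * inner ℂ (weakDeriv φ) (weakDeriv u)
      + inner ℂ φ (-weakDeriv^[4] u + δ • weakDeriv^[2] u)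
    = starRingEnd ℂ (pointValue φ 0)
        * (pointValue (weakDeriv^[3] u) 0 - δ * pointValue (weakDeriv u) 0)
      - starRingEnd ℂ (pointValue (weakDeriv φ) 0) * pointValue (weakDeriv^[2] u) 0 := by
  have hφ' : HasWeakDeriv φ (weakDeriv φ) := hasWeakDeriv_iterate hφ.1 two_pos
  have hφ'' : HasWeakDeriv (weakDeriv φ) (weakDeriv^[2] φ) :=
    hasWeakDeriv_iterate hφ.1 one_lt_two
  have by_parts₁ := hφ'.inner_add_inner (hasWeakDeriv_iterate (n := 1) hu (by norm_num))
  have by_parts₂ := hφ''.inner_add_inner (hasWeakDeriv_iterate (n := 2) hu (by norm_num))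
  have by_parts₃ := hφ'.inner_add_inner (hasWeakDeriv_iterate (n := 3) hu (by norm_num))
  rw [hφ.2.2, map_zero] at by_parts₁ by_parts₃
  rw [hu1] at by_parts₂
  rw [Function.iterate_one] at by_parts₁
  rw [inner_add_right, inner_neg_right, inner_smul_right]
  linear_combination by_parts₂ - by_parts₃ + δ * by_parts₁

lemma regularity_of_weak_solution {w G : L2} {δ : ℂ} (hw : w ∈ sobolev 2)
    (h : ∀ φ ∈ sobolevStar 2, pointValue φ 0 = 0 → pointValue (weakDeriv φ) 0 = 0 →
      inner ℂ (weakDeriv^[2] φ) (weakDeriv^[2] w) + δ * inner ℂ (weakDeriv φ) (weakDeriv w)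
        = -inner ℂ φ G) :
    w ∈ sobolev 4 ∧ pointValue (weakDeriv^[2] w) 1 = 0 ∧
      -weakDeriv^[4] w + δ • weakDeriv^[2] w = G := by
  have hw' : HasWeakDeriv w (weakDeriv w) := hasWeakDeriv_iterate hw two_pos
  have hw'' : HasWeakDeriv (weakDeriv w) (weakDeriv^[2] w) := hasWeakDeriv_iterate hw one_lt_two
  obtain ⟨w₃, hw₃, hw₄, w''_one⟩ := exists_hasWeakDeriv_of_forall_inner_eq
    (u := weakDeriv^[2] w) (q := δ • weakDeriv^[2] w - G)
    fun φ φ' φ'' hφ hφ' φ_zero φ'_zero φ_one => by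
      have weak_eq := h φ (mem_sobolevStar_two hφ hφ' φ_one) φ_zero (hφ.weakDeriv_eq ▸ φ'_zero)
      have by_parts := hφ.inner_add_inner hw''
      rw [hφ.iterate_two_eq hφ', hφ.weakDeriv_eq] at weak_eq
      rw [φ_zero, φ_one, map_zero] at by_parts
      rw [inner_sub_right, inner_smul_right]
      linear_combination weak_eq - δ * by_parts
  refine ⟨⟨_, ⟨_, ⟨_, ⟨_, trivial, hw₄⟩, hw₃⟩, hw''⟩, hw'⟩, w''_one, ?_⟩
  rw [Function.iterate_add_apply _ 2 2, hw₃.iterate_two_eq hw₄]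
  abel

/-! ### The components of a state -/

lemma Params.stiffness_pos (P : Params) : 0 < P.γ - P.η ^ 2 := sub_pos.2 P.sq_η_lt_γ

namespace StateSpace

variable {P : Params}

lemma hasWeakDeriv_w (x : StateSpace P) (k : Fin 3) : HasWeakDeriv (x.w k) (weakDeriv (x.w k)) :=
  hasWeakDeriv_of_mem (x.w_mem_sobolev_one k)

lemma hasWeakDeriv_weakDeriv_w (x : StateSpace P) (k : Fin 3) :
    HasWeakDeriv (weakDeriv (x.w k)) (weakDeriv^[2] (x.w k)) :=
  hasWeakDeriv_of_mem (x.weakDeriv_w_mem k)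

lemma pointValue_w_one (x : StateSpace P) (k : Fin 3) : pointValue (x.w k) 1 = 0 :=
  (x.w_mem.1 k).2.2

lemma norm_sq_eq (x : StateSpace P) : ‖x‖ ^ 2 =
    ∑ k, (‖weakDeriv^[2] (x.w k)‖ ^ 2 + (P.γ - P.η ^ 2) * ‖weakDeriv (x.w k)‖ ^ 2
        + P.α * ‖pointValue (weakDeriv (x.w k)) 0‖ ^ 2) + ∑ k, ‖x.v k‖ ^ 2 := by
  rw [← inner_self_eq_norm_sq (𝕜 := ℂ), inner_self, RCLike.re_to_complex, Complex.ofReal_re]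

lemma norm_sq_component_le (x : StateSpace P) (k : Fin 3) :
    ‖weakDeriv^[2] (x.w k)‖ ^ 2 + (P.γ - P.η ^ 2) * ‖weakDeriv (x.w k)‖ ^ 2 + ‖x.v k‖ ^ 2
      ≤ ‖x‖ ^ 2 := by
  have stiffness_pos := P.stiffness_pos
  have α_nonneg := P.α_nonneg
  rw [norm_sq_eq]
  refine add_le_add ?_ (Finset.single_le_sum (f := fun k => ‖x.v k‖ ^ 2)
    (fun _ _ => by positivity) (Finset.mem_univ k))
  exact (le_add_of_nonneg_right (by positivity)).trans (Finset.single_le_sum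
    (f := fun k => ‖weakDeriv^[2] (x.w k)‖ ^ 2 + (P.γ - P.η ^ 2) * ‖weakDeriv (x.w k)‖ ^ 2
      + P.α * ‖pointValue (weakDeriv (x.w k)) 0‖ ^ 2)
    (fun _ _ => by positivity) (Finset.mem_univ k))

lemma norm_v_le (x : StateSpace P) (k : Fin 3) : ‖x.v k‖ ≤ ‖x‖ := by
  refine le_of_sq_le_sq ?_ (norm_nonneg x)
  nlinarith [x.norm_sq_component_le k, P.stiffness_pos, sq_nonneg ‖weakDeriv (x.w k)‖,
    sq_nonneg ‖weakDeriv^[2] (x.w k)‖]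

lemma norm_iterate_weakDeriv_w_le (x : StateSpace P) (k : Fin 3) :
    ‖weakDeriv^[2] (x.w k)‖ ≤ ‖x‖ := by
  refine le_of_sq_le_sq ?_ (norm_nonneg x)
  nlinarith [x.norm_sq_component_le k, P.stiffness_pos, sq_nonneg ‖weakDeriv (x.w k)‖,
    sq_nonneg ‖x.v k‖]

lemma norm_weakDeriv_w_le (x : StateSpace P) (k : Fin 3) :
    ‖weakDeriv (x.w k)‖ ≤ (√(P.γ - P.η ^ 2))⁻¹ * ‖x‖ := by
  rw [inv_mul_eq_div, le_div_iff₀ (Real.sqrt_pos.2 P.stiffness_pos)]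
  refine le_of_sq_le_sq ?_ (norm_nonneg x)
  rw [mul_pow, Real.sq_sqrt P.stiffness_pos.le, mul_comm]
  nlinarith [x.norm_sq_component_le k, sq_nonneg ‖weakDeriv^[2] (x.w k)‖, sq_nonneg ‖x.v k‖]

/-- The component `(w, v) ↦ vₖ`. -/
def velocity (k : Fin 3) : StateSpace P →L[ℂ] L2 :=
  LinearMap.mkContinuous ⟨⟨fun x => x.v k, fun _ _ => rfl⟩, fun _ _ => rfl⟩ 1
    fun x => by rw [one_mul]; exact norm_v_le x k

/-- The component `(w, v) ↦ wₖ''`. -/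
def curvature (k : Fin 3) : StateSpace P →L[ℂ] L2 :=
  LinearMap.mkContinuous ⟨⟨fun x => weakDeriv^[2] (x.w k), fun x y =>
      iterate_weakDeriv_add 2 (x.w_mem_sobolev_two k) (y.w_mem_sobolev_two k)⟩,
      fun c x => iterate_weakDeriv_smul 2 c (x.w_mem_sobolev_two k)⟩ 1
    fun x => by rw [one_mul]; exact norm_iterate_weakDeriv_w_le x k

/-- The component `(w, v) ↦ wₖ'`. -/
def slope (k : Fin 3) : StateSpace P →L[ℂ] L2 :=
  LinearMap.mkContinuous ⟨⟨fun x => weakDeriv (x.w k), fun x y =>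
      weakDeriv_add (x.w_mem_sobolev_one k) (y.w_mem_sobolev_one k)⟩,
      fun c x => weakDeriv_smul c (x.w_mem_sobolev_one k)⟩ (√(P.γ - P.η ^ 2))⁻¹
    fun x => norm_weakDeriv_w_le x k

/-- The component `(w, v) ↦ wₖ`. -/
def displacement (k : Fin 3) : StateSpace P →L[ℂ] L2 :=
  LinearMap.mkContinuous ⟨⟨fun x => x.w k, fun _ _ => rfl⟩, fun _ _ => rfl⟩
    (√(P.γ - P.η ^ 2))⁻¹ fun x =>
      ((hasWeakDeriv_w x k).norm_le (x.pointValue_w_one k)).trans (norm_weakDeriv_w_le x k)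

/-- The trace `(w, v) ↦ wₖ(0)`, written as `-∫₀¹ wₖ'`. -/
def displacementZero (k : Fin 3) : StateSpace P →L[ℂ] ℂ := -(innerSL ℂ one ∘L slope k)

/-- The trace `(w, v) ↦ wₖ'(0)`, written by Taylor's formula as
`-wₖ(0) - ∫₀¹ (1 - s) wₖ''(s) ds`. -/
def slopeZero (k : Fin 3) : StateSpace P →L[ℂ] ℂ :=
  -(displacementZero k + innerSL ℂ ramp ∘L curvature k)

@[simp] lemma velocity_apply (k : Fin 3) (x : StateSpace P) : velocity k x = x.v k := rfl

@[simp] lemma curvature_apply (k : Fin 3) (x : StateSpace P) :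
    curvature k x = weakDeriv^[2] (x.w k) := rfl

@[simp] lemma slope_apply (k : Fin 3) (x : StateSpace P) : slope k x = weakDeriv (x.w k) := rfl

@[simp] lemma displacement_apply (k : Fin 3) (x : StateSpace P) : displacement k x = x.w k := rfl

@[simp] lemma displacementZero_apply (k : Fin 3) (x : StateSpace P) :
    displacementZero k x = pointValue (x.w k) 0 := by
  change -inner ℂ one (weakDeriv (x.w k)) = _
  rw [(hasWeakDeriv_w x k).inner_one, x.pointValue_w_one]
  ring

@[simp] lemma slopeZero_apply (k : Fin 3) (x : StateSpace P) :
    slopeZero k x = pointValue (weakDeriv (x.w k)) 0 := by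
  have taylor := (hasWeakDeriv_w x k).taylor (hasWeakDeriv_weakDeriv_w x k)
  change -(displacementZero k x + inner ℂ ramp (weakDeriv^[2] (x.w k))) = _
  rw [x.pointValue_w_one] at taylor
  rw [displacementZero_apply]
  linear_combination taylor

/-- The triples `(wₖ', wₖ'', vₖ)`, which embed the state space as a closed subspace of a product
of `L₂(0,1)`. -/
def jet : StateSpace P →L[ℂ] Fin 3 → L2 × L2 × L2 :=
  .pi fun k => (slope k).prod ((curvature k).prod (velocity k))

lemma norm_slope_le_norm_jet (k : Fin 3) (x : StateSpace P) : ‖slope k x‖ ≤ ‖jet x‖ :=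
  (norm_fst_le _).trans (norm_le_pi_norm (jet x) k)

lemma norm_curvature_le_norm_jet (k : Fin 3) (x : StateSpace P) : ‖curvature k x‖ ≤ ‖jet x‖ :=
  (norm_fst_le _).trans ((norm_snd_le _).trans (norm_le_pi_norm (jet x) k))

lemma norm_velocity_le_norm_jet (k : Fin 3) (x : StateSpace P) : ‖velocity k x‖ ≤ ‖jet x‖ :=
  (norm_snd_le _).trans ((norm_snd_le _).trans (norm_le_pi_norm (jet x) k))

lemma norm_slopeZero_le_norm_jet (k : Fin 3) (x : StateSpace P) :
    ‖slopeZero k x‖ ≤ (1 + ‖ramp‖) * ‖jet x‖ := by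
  calc ‖slopeZero k x‖ = ‖-inner ℂ one (slope k x) + inner ℂ ramp (curvature k x)‖ :=
        norm_neg _
    _ ≤ ‖one‖ * ‖slope k x‖ + ‖ramp‖ * ‖curvature k x‖ :=
        (norm_add_le _ _).trans (add_le_add ((norm_neg _).trans_le (norm_inner_le_norm _ _))
          (norm_inner_le_norm _ _))
    _ ≤ 1 * ‖jet x‖ + ‖ramp‖ * ‖jet x‖ := by
        rw [PipeNetwork.norm_one]
        gcongr
        exacts [norm_slope_le_norm_jet k x, norm_curvature_le_norm_jet k x]
    _ = (1 + ‖ramp‖) * ‖jet x‖ := by ring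

lemma exists_antilipschitzWith_jet : ∃ C, AntilipschitzWith C (jet (P := P)) := by
  have stiffness_pos := P.stiffness_pos
  have α_nonneg := P.α_nonneg
  let C : ℝ := 3 * (1 + (P.γ - P.η ^ 2) + P.α * (1 + ‖ramp‖) ^ 2) + 3
  have C_nonneg : 0 ≤ C := by positivity
  refine ⟨⟨√C, C.sqrt_nonneg⟩, jet.antilipschitz_of_bound fun x => ?_⟩
  refine le_of_sq_le_sq ?_ (mul_nonneg C.sqrt_nonneg (norm_nonneg _))
  rw [norm_sq_eq]
  simp only [← slopeZero_apply]
  simp only [← curvature_apply, ← slope_apply, ← velocity_apply]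
  calc _ ≤ ∑ _k : Fin 3, (‖jet x‖ ^ 2 + (P.γ - P.η ^ 2) * ‖jet x‖ ^ 2
          + P.α * ((1 + ‖ramp‖) * ‖jet x‖) ^ 2) + ∑ _k : Fin 3, ‖jet x‖ ^ 2 := by
        gcongr with k _ k _
        exacts [norm_curvature_le_norm_jet k x, norm_slope_le_norm_jet k x,
          norm_slopeZero_le_norm_jet k x, norm_velocity_le_norm_jet k x]
    _ = C * ‖jet x‖ ^ 2 := by
        simp only [Finset.sum_const, Finset.card_univ, Fintype.card_fin, nsmul_eq_mul, C]
        push_cast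
        ring
    _ = (√C * ‖jet x‖) ^ 2 := by rw [mul_pow, Real.sq_sqrt C_nonneg]

lemma range_jet : range (jet (P := P)) = {b | (∀ k, HasWeakDeriv (b k).1 (b k).2.1) ∧
    ∀ j k, inner ℂ one (b j).1 = inner ℂ one (b k).1} := by
  refine Subset.antisymm ?_ fun b ⟨hb, inner_eq⟩ => ?_
  · rintro _ ⟨x, rfl⟩
    refine ⟨hasWeakDeriv_weakDeriv_w x, fun j k => neg_injective ?_⟩
    change displacementZero j x = displacementZero k x
    simpa only [displacementZero_apply] using x.w_mem.2 j k
  · choose w hw w_one using fun k => exists_hasWeakDeriv_pointValue_one_eq_zero (b k).1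
    have hmem : w ∈ H2StarG := by
      refine ⟨fun k => mem_sobolevStar_two (hw k) (hb k) (w_one k), fun j k => ?_⟩
      have value_eq := inner_eq j k
      rwa [(hw j).inner_one, (hw k).inner_one, w_one, w_one, zero_sub, zero_sub, neg_inj]
        at value_eq
    exact ⟨mk w (fun k => (b k).2.2) hmem, funext fun k => Prod.ext (hw k).weakDeriv_eq
      (Prod.ext ((hw k).iterate_two_eq (hb k)) rfl)⟩

lemma isClosed_range_jet : IsClosed (range (jet (P := P))) := by
  rw [range_jet, ofPred_and]
  simp only [ofPred_forall]
  refine IsClosed.inter (isClosed_iInter fun k => ?_)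
    (isClosed_iInter fun j => isClosed_iInter fun k => isClosed_eq (by fun_prop) (by fun_prop))
  exact isClosed_setOf_hasWeakDeriv.preimage
    (f := fun b : Fin 3 → L2 × L2 × L2 => ((b k).1, (b k).2.1)) (by fun_prop)

instance : CompleteSpace (StateSpace P) :=
  have ⟨_, hC⟩ := exists_antilipschitzWith_jet (P := P)
  (completeSpace_iff_isComplete_range (hC.isUniformInducing jet.uniformContinuous)).2
    isClosed_range_jet.isComplete

end StateSpace

/-! ### Bounded dissipative operators -/

section Dissipative

variable {H : Type*} [NormedAddCommGroup H] [InnerProductSpace ℂ H]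

lemma hasDerivAt_norm_sq {u : ℝ → H} {u' : H} {t : ℝ} (hu : HasDerivAt u u' t) :
    HasDerivAt (fun s => ‖u s‖ ^ 2) (2 * (inner ℂ u' (u t)).re) t := by
  have deriv_inner := Complex.reCLM.hasFDerivAt.comp_hasDerivAt t (hu.inner ℂ hu)
  have inner_symm : (inner ℂ (u t) u').re = (inner ℂ u' (u t)).re := inner_re_symm (𝕜 := ℂ) _ _
  have norm_sq : (fun s => ‖u s‖ ^ 2) = Complex.reCLM ∘ fun s => inner ℂ (u s) (u s) :=
    funext fun s => (inner_self_eq_norm_sq (𝕜 := ℂ) (u s)).symm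
  rw [norm_sq]
  refine deriv_inner.congr_deriv ?_
  rw [Complex.reCLM_apply, Complex.add_re, inner_symm, two_mul]

lemma norm_le_of_re_inner_deriv_nonpos {u u' : ℝ → H} (hu : ContinuousOn u (Ici 0))
    (deriv_u : ∀ t, 0 < t → HasDerivAt u (u' t) t)
    (inner_nonpos : ∀ t, 0 < t → (inner ℂ (u' t) (u t)).re ≤ 0) {t : ℝ} (ht : 0 ≤ t) :
    ‖u t‖ ≤ ‖u 0‖ := by
  have antitone : AntitoneOn (fun s => ‖u s‖ ^ 2) (Ici 0) := by
    refine antitoneOn_of_hasDerivWithinAt_nonpos (convex_Ici 0) (hu.norm.pow 2)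
      (f' := fun s => 2 * (inner ℂ (u' s) (u s)).re) (fun s hs => ?_) fun s hs => ?_
    all_goals rw [interior_Ici] at hs
    · exact (hasDerivAt_norm_sq (deriv_u s hs)).hasDerivWithinAt
    · linarith [inner_nonpos s hs]
  exact le_of_sq_le_sq (antitone self_mem_Ici ht ht) (norm_nonneg _)

/-- A bounded operator `K` is dissipative if `Re ⟪K x, x⟫ ≤ 0` for all `x`. -/
def IsDissipative (K : H →L[ℂ] H) : Prop := ∀ x, (inner ℂ (K x) x).re ≤ 0

/-- The operators `(K - 1/(n+1))⁻¹`. They are the Yosida approximations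
`λ T (λ - T)⁻¹`, `λ = n + 1`, of `T = K⁻¹`. -/
def yosida (K : H →L[ℂ] H) (n : ℕ) : H →L[ℂ] H := -resolvent K (1 / ((n : ℝ) + 1))

lemma commute_resolvent {B K : H →L[ℂ] H} (h : Commute B K) (ε : ℝ) :
    Commute B (resolvent K ε) := by
  have commute_sub : Commute B (algebraMap ℝ (H →L[ℂ] H) ε - K) :=
    (Algebra.commute_algebraMap_right ε B).sub_right h
  by_cases unit : IsUnit (algebraMap ℝ (H →L[ℂ] H) ε - K)
  · obtain ⟨U, hU⟩ := unit
    rw [resolvent, ← hU, Ring.inverse_unit]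
    exact (hU ▸ commute_sub).units_inv_right
  · rw [resolvent, Ring.inverse_non_unit _ unit]
    exact Commute.zero_right B

lemma commute_yosida {B K : H →L[ℂ] H} (h : Commute B K) (n : ℕ) : Commute B (yosida K n) :=
  (commute_resolvent h _).neg_right

lemma commute_yosida_yosida (K : H →L[ℂ] H) (m n : ℕ) : Commute (yosida K m) (yosida K n) :=
  commute_yosida (commute_yosida (Commute.refl K) m).symm n

lemma tendsto_zero_of_denseRange {E F G ι : Type*} [NormedAddCommGroup E] [NormedSpace ℂ E]
    [NormedAddCommGroup F] [NormedSpace ℂ F] {l : Filter ι} {A : ι → E →L[ℂ] F} {C : ℝ}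
    (norm_le : ∀ i x, ‖A i x‖ ≤ C * ‖x‖) {f : G → E} (hf : DenseRange f)
    (tendsto_range : ∀ y, Tendsto (fun i => A i (f y)) l (𝓝 0)) (x : E) :
    Tendsto (fun i => A i x) l (𝓝 0) := by
  have lipschitz : ∀ i, LipschitzWith C.toNNReal (A i) := fun i =>
    AddMonoidHomClass.lipschitz_of_bound (A i) C (norm_le i)
  exact hf.induction_on (p := fun x => Tendsto (fun i => A i x) l (𝓝 0)) x
    ((LipschitzWith.uniformEquicontinuous _ _ lipschitz).equicontinuous.isClosed_setOfPred_tendsto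
      continuous_const) tendsto_range

namespace IsDissipative

variable {K : H →L[ℂ] H} {ε : ℝ}

lemma mul_norm_sq_le_re_inner (hK : IsDissipative K) (ε : ℝ) (x : H) :
    ε * ‖x‖ ^ 2 ≤ (inner ℂ (ε • x - K x) x).re := by
  have inner_self : (inner ℂ x x).re = ‖x‖ ^ 2 := inner_self_eq_norm_sq (𝕜 := ℂ) x
  rw [inner_sub_left, ← Complex.coe_smul, inner_smul_left, Complex.conj_ofReal, Complex.sub_re,
    Complex.re_ofReal_mul, inner_self]
  linarith [hK x]

variable [CompleteSpace H]

lemma isUnit_algebraMap_sub (hK : IsDissipative K) (hε : 0 < ε) :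
    IsUnit (algebraMap ℝ (H →L[ℂ] H) ε - K) := by
  refine ContinuousLinearMap.isUnit_of_forall_le_norm_inner_map _ (c := ⟨ε, hε.le⟩) hε fun x => ?_
  rw [mul_comm]
  exact (hK.mul_norm_sq_le_re_inner ε x).trans (Complex.re_le_norm _)

lemma resolvent_apply_sub (hK : IsDissipative K) (hε : 0 < ε) (x : H) :
    resolvent K ε (ε • x - K x) = x :=
  DFunLike.congr_fun (Ring.inverse_mul_cancel _ (hK.isUnit_algebraMap_sub hε)) x

lemma resolvent_apply_apply (hK : IsDissipative K) (hε : 0 < ε) (x : H) :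
    resolvent K ε (K x) = ε • resolvent K ε x - x := by
  have cancel := hK.resolvent_apply_sub hε x
  rw [map_sub, ContinuousLinearMap.map_smul_of_tower] at cancel
  nth_rewrite 3 [← cancel]
  abel

lemma smul_resolvent_sub (hK : IsDissipative K) (hε : 0 < ε) (y : H) :
    ε • resolvent K ε y - K (resolvent K ε y) = y :=
  DFunLike.congr_fun (Ring.mul_inverse_cancel _ (hK.isUnit_algebraMap_sub hε)) y

lemma mul_norm_sq_resolvent_le (hK : IsDissipative K) (hε : 0 < ε) (y : H) :
    ε * ‖resolvent K ε y‖ ^ 2 ≤ (inner ℂ y (resolvent K ε y)).re := by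
  simpa only [hK.smul_resolvent_sub hε] using hK.mul_norm_sq_le_re_inner ε (resolvent K ε y)

lemma norm_smul_resolvent_le (hK : IsDissipative K) (hε : 0 < ε) (y : H) :
    ‖ε • resolvent K ε y‖ ≤ ‖y‖ := by
  have cauchy_schwarz : ε * ‖resolvent K ε y‖ ^ 2 ≤ ‖y‖ * ‖resolvent K ε y‖ :=
    (hK.mul_norm_sq_resolvent_le hε y).trans (re_inner_le_norm (𝕜 := ℂ) _ _)
  rw [norm_smul, Real.norm_of_nonneg hε.le]
  rcases (norm_nonneg (resolvent K ε y)).eq_or_lt with h | h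
  · rw [← h, mul_zero]
    exact norm_nonneg y
  · nlinarith

lemma denseRange (hK : IsDissipative K) (hinj : Function.Injective K) : DenseRange K := by
  suffices orthogonal_eq_bot : (LinearMap.range K.toLinearMap)ᗮ = ⊥ from
    Submodule.dense_iff_topologicalClosure_eq_top.2
      (Submodule.topologicalClosure_eq_top_iff.2 orthogonal_eq_bot)
  refine (Submodule.eq_bot_iff _).2 fun z hz => ?_
  obtain ⟨u, rfl⟩ : ∃ u, u - K u = z := ⟨resolvent K (1 : ℝ) z, by
    simpa only [one_smul] using hK.smul_resolvent_sub one_pos z⟩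
  have inner_eq : inner ℂ (K u) u = inner ℂ (K u) (K u) := by
    rw [← sub_eq_zero, ← inner_sub_right]
    exact hz _ ⟨u, rfl⟩
  have norm_sq_nonpos : (inner ℂ (K u) (K u)).re ≤ 0 := inner_eq ▸ hK u
  have Ku_eq_zero : K u = 0 := (re_inner_self_nonpos (𝕜 := ℂ)).1 norm_sq_nonpos
  rw [Ku_eq_zero, sub_zero]
  exact hinj (Ku_eq_zero.trans (map_zero K).symm)

lemma tendsto_smul_resolvent (hK : IsDissipative K) (hinj : Function.Injective K) {ε : ℕ → ℝ}
    (hε : ∀ n, 0 < ε n) (tendsto_ε : Tendsto ε atTop (𝓝 0)) (x : H) :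
    Tendsto (fun n => ε n • resolvent K (ε n) x) atTop (𝓝 0) := by
  refine tendsto_zero_of_denseRange (A := fun n => ε n • resolvent K (ε n)) (C := 1)
    (fun n x => (one_mul ‖x‖).symm ▸ hK.norm_smul_resolvent_le (hε n) x) (hK.denseRange hinj)
    (fun y => ?_) x
  refine squeeze_zero_norm (a := fun n => ε n * (2 * ‖y‖)) (fun n => ?_)
    (by simpa using tendsto_ε.mul_const (2 * ‖y‖))
  calc ‖ε n • resolvent K (ε n) (K y)‖ = ε n * ‖ε n • resolvent K (ε n) y - y‖ := by
        rw [hK.resolvent_apply_apply (hε n), norm_smul, Real.norm_of_nonneg (hε n).le]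
    _ ≤ ε n * (2 * ‖y‖) := by
        refine mul_le_mul_of_nonneg_left ((norm_sub_le _ _).trans ?_) (hε n).le
        linarith [hK.norm_smul_resolvent_le (hε n) y]

protected lemma yosida (hK : IsDissipative K) (n : ℕ) : IsDissipative (yosida K n) := fun y => by
  have hε : (0 : ℝ) < 1 / ((n : ℝ) + 1) := Nat.one_div_pos_of_nat
  have inner_nonneg : 0 ≤ (inner ℂ y (resolvent K (1 / ((n : ℝ) + 1)) y)).re :=
    (by positivity : (0 : ℝ) ≤ _).trans (hK.mul_norm_sq_resolvent_le hε y)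
  have inner_symm := inner_re_symm (𝕜 := ℂ) y (resolvent K (1 / ((n : ℝ) + 1)) y)
  rw [yosida, _root_.neg_apply, inner_neg_left, Complex.neg_re, neg_nonpos]
  exact inner_nonneg.trans_eq inner_symm

lemma tendsto_yosida (hK : IsDissipative K) (hinj : Function.Injective K) (y : H) :
    Tendsto (fun n => yosida K n (K y)) atTop (𝓝 y) := by
  have yosida_K : ∀ n : ℕ, y - (1 / ((n : ℝ) + 1)) • resolvent K (1 / ((n : ℝ) + 1)) y
      = yosida K n (K y) := fun n => by
    rw [yosida, _root_.neg_apply, hK.resolvent_apply_apply Nat.one_div_pos_of_nat, neg_sub]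
  simpa only [yosida_K, sub_zero] using (hK.tendsto_smul_resolvent hinj
    (fun _ => Nat.one_div_pos_of_nat) tendsto_one_div_add_atTop_nhds_zero_nat y).const_sub y

end IsDissipative

end Dissipative

/-! ### The contraction semigroup of the inverse of a dissipative operator -/

section Semigroup

variable {H : Type*} [NormedAddCommGroup H] [InnerProductSpace ℂ H] [CompleteSpace H]

lemma exp_add_smul (A : H →L[ℂ] H) (s t : ℝ) :
    NormedSpace.exp ((s + t) • A) = NormedSpace.exp (s • A) * NormedSpace.exp (t • A) := by
  let _ : NormedAlgebra ℚ (H →L[ℂ] H) := .restrictScalars ℚ ℂ _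
  rw [add_smul]
  exact NormedSpace.exp_add_of_commute (((Commute.refl A).smul_left s).smul_right t)

lemma exp_smul_apply_comm {A B : H →L[ℂ] H} (h : Commute B A) (t : ℝ) (x : H) :
    NormedSpace.exp (t • A) (B x) = B (NormedSpace.exp (t • A) x) :=
  DFunLike.congr_fun (h.smul_right t).exp_right.symm x

lemma hasDerivAt_exp_smul_apply (A : H →L[ℂ] H) (x : H) (t : ℝ) :
    HasDerivAt (fun s : ℝ => NormedSpace.exp (s • A) x) (A (NormedSpace.exp (t • A) x)) t :=
  ((ContinuousLinearMap.apply ℂ H x).restrictScalars ℝ).hasFDerivAt.comp_hasDerivAt t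
    (hasDerivAt_exp_smul_const' A t)

lemma continuous_exp_smul_apply (A : H →L[ℂ] H) (x : H) :
    Continuous fun t : ℝ => NormedSpace.exp (t • A) x :=
  continuous_iff_continuousAt.2 fun t => (hasDerivAt_exp_smul_apply A x t).continuousAt

lemma exp_smul_apply_eq_add_integral (A : H →L[ℂ] H) (x : H) (t : ℝ) :
    NormedSpace.exp (t • A) x = x + ∫ s in (0 : ℝ)..t, NormedSpace.exp (s • A) (A x) := by
  rw [intervalIntegral.integral_eq_sub_of_hasDerivAt (f := fun s => NormedSpace.exp (s • A) x)
    (fun s _ => exp_smul_apply_comm (Commute.refl A) s x ▸ hasDerivAt_exp_smul_apply A x s)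
    ((continuous_exp_smul_apply A (A x)).intervalIntegrable 0 t)]
  simp

lemma hasDerivAt_exp_smul_apply_exp_smul_apply {A B : H →L[ℂ] H} (h : Commute A B) (x : H)
    (t s : ℝ) :
    HasDerivAt (fun s => NormedSpace.exp (s • A) (NormedSpace.exp ((t - s) • B) x))
      (NormedSpace.exp (s • A) (NormedSpace.exp ((t - s) • B) (A x - B x))) s := by
  have deriv_right := (hasDerivAt_exp_smul_const' B (t - s)).scomp s
    ((hasDerivAt_id s).const_sub t)
  have deriv_mul := (hasDerivAt_exp_smul_const' A s).mul deriv_right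
  refine (((ContinuousLinearMap.apply ℂ H x).restrictScalars ℝ).hasFDerivAt.comp_hasDerivAt s
    deriv_mul).congr_deriv ?_
  change A (NormedSpace.exp (s • A) (NormedSpace.exp ((t - s) • B) x))
    + NormedSpace.exp (s • A) ((-1 : ℝ) • B (NormedSpace.exp ((t - s) • B) x)) = _
  rw [← exp_smul_apply_comm (Commute.refl A), ← exp_smul_apply_comm (Commute.refl B),
    ← exp_smul_apply_comm h, neg_one_smul, map_sub, map_sub, map_neg,
    ← sub_eq_add_neg]

namespace IsDissipative

variable {A B K : H →L[ℂ] H} {s t : ℝ}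

lemma norm_exp_smul_apply_le (hA : IsDissipative A) (ht : 0 ≤ t) (x : H) :
    ‖NormedSpace.exp (t • A) x‖ ≤ ‖x‖ := by
  simpa using norm_le_of_re_inner_deriv_nonpos (continuous_exp_smul_apply A x).continuousOn
    (fun t _ => hasDerivAt_exp_smul_apply A x t) (fun t _ => hA _) ht

lemma norm_exp_smul_apply_sub_exp_smul_apply_le (hA : IsDissipative A) (hB : IsDissipative B)
    (h : Commute A B) (ht : 0 ≤ t) (x : H) :
    ‖NormedSpace.exp (t • A) x - NormedSpace.exp (t • B) x‖ ≤ t * ‖A x - B x‖ := by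
  simpa [mul_comm] using norm_image_sub_le_of_norm_deriv_le_segment' (a := 0) (b := t)
    (fun s _ => (hasDerivAt_exp_smul_apply_exp_smul_apply h x t s).hasDerivWithinAt)
    (C := ‖A x - B x‖) (fun s hs => (hA.norm_exp_smul_apply_le hs.1 _).trans
      (hB.norm_exp_smul_apply_le (sub_nonneg.2 hs.2.le) _)) t ⟨ht, le_rfl⟩

lemma norm_exp_smul_apply_sub_le (hA : IsDissipative A) (hs : 0 ≤ s) (ht : 0 ≤ t) (x : H) :
    ‖NormedSpace.exp (t • A) x - NormedSpace.exp (s • A) x‖ ≤ ‖A x‖ * |t - s| := by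
  refine (convex_Ici (0 : ℝ)).norm_image_sub_le_of_norm_hasDerivWithin_le
    (f := fun t => NormedSpace.exp (t • A) x)
    (fun r _ => (hasDerivAt_exp_smul_apply A x r).hasDerivWithinAt) (fun r hr => ?_) hs ht
  rw [← exp_smul_apply_comm (Commute.refl A)]
  exact hA.norm_exp_smul_apply_le hr (A x)

lemma cauchySeq_exp_yosida (hK : IsDissipative K) (hinj : Function.Injective K) (ht : 0 ≤ t)
    (x : H) : CauchySeq fun n => NormedSpace.exp (t • yosida K n) x := by
  simp only [cauchySeq_iff_tendsto_dist_atTop_0, dist_eq_norm]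
  refine tendsto_zero_iff_norm_tendsto_zero.1 (tendsto_zero_of_denseRange
    (A := fun n : ℕ × ℕ =>
      NormedSpace.exp (t • yosida K n.1) - NormedSpace.exp (t • yosida K n.2)) (C := 2)
    (fun n x => ?_) (hK.denseRange hinj) (fun y => ?_) x)
  · rw [two_mul]
    exact (norm_sub_le _ _).trans (add_le_add ((hK.yosida n.1).norm_exp_smul_apply_le ht x)
      ((hK.yosida n.2).norm_exp_smul_apply_le ht x))
  · have cauchy := cauchySeq_iff_tendsto_dist_atTop_0.1 (hK.tendsto_yosida hinj y).cauchySeq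
    refine squeeze_zero_norm (fun n => ?_) (by simpa using cauchy.const_mul t)
    rw [dist_eq_norm]
    exact (hK.yosida n.1).norm_exp_smul_apply_sub_exp_smul_apply_le (hK.yosida n.2)
      (commute_yosida_yosida K n.1 n.2) ht (K y)

lemma exists_tendsto_exp_yosida (hK : IsDissipative K) (hinj : Function.Injective K) (t : ℝ) :
    ∃ S : H →L[ℂ] H, ∀ x,
      Tendsto (fun n => NormedSpace.exp (max t 0 • yosida K n) x) atTop (𝓝 (S x)) := by
  choose f hf using fun x =>
    cauchySeq_tendsto_of_complete (hK.cauchySeq_exp_yosida hinj (le_max_right t 0) x)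
  exact ⟨continuousLinearMapOfTendsto (fun n => NormedSpace.exp (max t 0 • yosida K n))
    (tendsto_pi_nhds.2 hf), hf⟩

/-- The contraction semigroup generated by the inverse of an injective dissipative operator `K`:
the strong limit of the exponentials of the Yosida approximations of `K⁻¹`, extended by `1` to
negative times. -/
def semigroup (hK : IsDissipative K) (hinj : Function.Injective K) (t : ℝ) : H →L[ℂ] H :=
  (hK.exists_tendsto_exp_yosida hinj t).choose

variable (hK : IsDissipative K) (hinj : Function.Injective K)

lemma tendsto_semigroup (t : ℝ) (x : H) :
    Tendsto (fun n => NormedSpace.exp (max t 0 • yosida K n) x) atTop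
      (𝓝 (hK.semigroup hinj t x)) :=
  (hK.exists_tendsto_exp_yosida hinj t).choose_spec x

lemma tendsto_semigroup_of_tendsto (t : ℝ) {u : ℕ → H} {x : H} (hu : Tendsto u atTop (𝓝 x)) :
    Tendsto (fun n => NormedSpace.exp (max t 0 • yosida K n) (u n)) atTop
      (𝓝 (hK.semigroup hinj t x)) := by
  have error_tendsto :
      Tendsto (fun n => NormedSpace.exp (max t 0 • yosida K n) (u n - x)) atTop (𝓝 0) :=
    squeeze_zero_norm (fun n => (hK.yosida n).norm_exp_smul_apply_le (le_max_right _ _) _)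
      (tendsto_iff_norm_sub_tendsto_zero.1 hu)
  simpa only [map_sub, sub_add_cancel, zero_add] using
    error_tendsto.add (hK.tendsto_semigroup hinj t x)

lemma semigroup_zero : hK.semigroup hinj 0 = 1 := by
  ext x
  refine tendsto_nhds_unique (hK.tendsto_semigroup hinj 0 x) ?_
  simp only [max_self, zero_smul, NormedSpace.exp_zero]
  exact tendsto_const_nhds

lemma semigroup_add (hs : 0 ≤ s) (ht : 0 ≤ t) :
    hK.semigroup hinj (s + t) = (hK.semigroup hinj s).comp (hK.semigroup hinj t) := by
  ext x
  have tendsto_comp :=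
    hK.tendsto_semigroup_of_tendsto hinj s (hK.tendsto_semigroup hinj t x)
  refine tendsto_nhds_unique (hK.tendsto_semigroup hinj (s + t) x) (tendsto_comp.congr fun n => ?_)
  rw [max_eq_left hs, max_eq_left ht, max_eq_left (add_nonneg hs ht), exp_add_smul]
  rfl

lemma norm_semigroup_apply_le (t : ℝ) (x : H) : ‖hK.semigroup hinj t x‖ ≤ ‖x‖ :=
  le_of_tendsto (hK.tendsto_semigroup hinj t x).norm
    (Eventually.of_forall fun n => (hK.yosida n).norm_exp_smul_apply_le (le_max_right _ _) x)

lemma norm_semigroup_le (t : ℝ) : ‖hK.semigroup hinj t‖ ≤ 1 :=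
  ContinuousLinearMap.opNorm_le_bound _ zero_le_one fun x =>
    (hK.norm_semigroup_apply_le hinj t x).trans_eq (one_mul _).symm

lemma semigroup_apply_apply (t : ℝ) (y : H) :
    hK.semigroup hinj t (K y) = K (hK.semigroup hinj t y) :=
  tendsto_nhds_unique (hK.tendsto_semigroup hinj t (K y))
    (((K.continuous.tendsto _).comp (hK.tendsto_semigroup hinj t y)).congr fun n =>
      (exp_smul_apply_comm (commute_yosida (Commute.refl K) n) _ y).symm)

lemma norm_semigroup_apply_sub_le (s t : ℝ) (y : H) :
    ‖hK.semigroup hinj t (K y) - hK.semigroup hinj s (K y)‖ ≤ ‖y‖ * |t - s| := by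
  refine le_of_tendsto_of_tendsto ((hK.tendsto_semigroup hinj t (K y)).sub
    (hK.tendsto_semigroup hinj s (K y))).norm
    ((hK.tendsto_yosida hinj y).norm.mul_const |t - s|) (Eventually.of_forall fun n => ?_)
  exact ((hK.yosida n).norm_exp_smul_apply_sub_le (le_max_right s 0) (le_max_right t 0) _).trans
    (mul_le_mul_of_nonneg_left (abs_max_sub_max_le_abs t s 0) (norm_nonneg _))

lemma continuous_semigroup_apply (x : H) : Continuous fun t => hK.semigroup hinj t x := by
  refine continuous_of_uniform_approx_of_continuous fun u hu => ?_
  obtain ⟨ε, hε, ball_subset⟩ := Metric.mem_uniformity_dist.1 hu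
  obtain ⟨y, dist_lt⟩ := (hK.denseRange hinj).exists_dist_lt x hε
  have lipschitz : LipschitzWith ‖y‖₊ fun t => hK.semigroup hinj t (K y) :=
    LipschitzWith.of_dist_le_mul fun t s => by
      rw [dist_eq_norm, Real.dist_eq]
      exact hK.norm_semigroup_apply_sub_le hinj s t y
  refine ⟨fun t => hK.semigroup hinj t (K y), lipschitz.continuous, fun t => ball_subset ?_⟩
  rw [dist_eq_norm, ← map_sub]
  exact (hK.norm_semigroup_apply_le hinj t _).trans_lt (dist_eq_norm x (K y) ▸ dist_lt)

lemma semigroup_apply_eq_add_integral (ht : 0 ≤ t) (y : H) :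
    hK.semigroup hinj t (K y) = K y + ∫ s in (0 : ℝ)..t, hK.semigroup hinj s y := by
  have yosida_tendsto := hK.tendsto_yosida hinj y
  obtain ⟨C, norm_yosida_le⟩ := yosida_tendsto.norm.bddAbove_range
  have integral_tendsto := intervalIntegral.tendsto_integral_filter_of_dominated_convergence
    (μ := volume) (a := 0) (b := t) (l := atTop)
    (F := fun n s => NormedSpace.exp (max s 0 • yosida K n) (yosida K n (K y))) (fun _ => C)
    (Eventually.of_forall fun n => ((continuous_exp_smul_apply (yosida K n) _).comp
      (continuous_id.max continuous_const)).aestronglyMeasurable)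
    (Eventually.of_forall fun n => Eventually.of_forall fun s _ =>
      ((hK.yosida n).norm_exp_smul_apply_le (le_max_right _ _) _).trans (norm_yosida_le ⟨n, rfl⟩))
    intervalIntegrable_const
    (Eventually.of_forall fun s _ => hK.tendsto_semigroup_of_tendsto hinj s yosida_tendsto)
  refine tendsto_nhds_unique (hK.tendsto_semigroup hinj t (K y))
    ((integral_tendsto.const_add (K y)).congr fun n => ?_)
  rw [max_eq_left ht, exp_smul_apply_eq_add_integral]
  refine congrArg (K y + ·) (intervalIntegral.integral_congr fun s hs => ?_)
  rw [uIcc_of_le ht] at hs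
  simp only [max_eq_left hs.1]

lemma hasDerivAt_add_integral_semigroup (y : H) (t : ℝ) :
    HasDerivAt (fun t => K y + ∫ s in (0 : ℝ)..t, hK.semigroup hinj s y)
      (hK.semigroup hinj t y) t :=
  have hc := hK.continuous_semigroup_apply hinj y
  (intervalIntegral.integral_hasDerivAt_right (hc.intervalIntegrable _ _)
    (hc.stronglyMeasurableAtFilter _ _) hc.continuousAt).const_add _

lemma hasDerivAt_semigroup_apply (ht : 0 < t) (y : H) :
    HasDerivAt (fun t => hK.semigroup hinj t (K y)) (hK.semigroup hinj t y) t :=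
  (hK.hasDerivAt_add_integral_semigroup hinj y t).congr_of_eventuallyEq <| by
    filter_upwards [lt_mem_nhds ht] with s hs
    exact hK.semigroup_apply_eq_add_integral hinj hs.le y

lemma contDiffOn_semigroup_apply (y : H) :
    ContDiffOn ℝ 1 (fun t => hK.semigroup hinj t (K y)) (Ioi 0) := by
  have hasDerivAt := hK.hasDerivAt_add_integral_semigroup hinj y
  have contDiff : ContDiff ℝ 1 fun t => K y + ∫ s in (0 : ℝ)..t, hK.semigroup hinj s y := by
    refine contDiff_one_iff_deriv.2 ⟨fun t => (hasDerivAt t).differentiableAt, ?_⟩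
    rw [funext fun t => (hasDerivAt t).deriv]
    exact hK.continuous_semigroup_apply hinj y
  exact contDiff.contDiffOn.congr fun t ht => hK.semigroup_apply_eq_add_integral hinj ht.le y

lemma tendsto_slope_semigroup (y : H) :
    Tendsto (fun t : ℝ => t⁻¹ • (hK.semigroup hinj t (K y) - K y)) (𝓝[>] 0) (𝓝 y) := by
  have tendsto_slope := (hasDerivAt_iff_tendsto_slope_zero.1
    (hK.hasDerivAt_add_integral_semigroup hinj y 0)).mono_left
      (nhdsWithin_mono 0 fun t (ht : 0 < t) => ht.ne')
  rw [hK.semigroup_zero hinj] at tendsto_slope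
  refine tendsto_slope.congr' ?_
  filter_upwards [self_mem_nhdsWithin] with t ht
  rw [hK.semigroup_apply_eq_add_integral hinj (le_of_lt ht)]
  simp

end IsDissipative

end Semigroup

/-! ### Generation and well-posedness -/

section Generation

variable {H : Type*} [NormedAddCommGroup H] [InnerProductSpace ℂ H] {T : H →ₗ.[ℂ] H}

lemma IsSolution.apply_eq {x₀ : H} {x₁ x₂ : ℝ → H}
    (dissipative : ∀ z : T.domain, (inner ℂ (T z) z.1).re ≤ 0) (h₁ : IsSolution T x₀ x₁)
    (h₂ : IsSolution T x₀ x₂) {t : ℝ} (ht : 0 ≤ t) : x₁ t = x₂ t := by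
  have hasDerivAt_sub : ∀ s (hs : 0 < s), HasDerivAt (fun s => x₁ s - x₂ s)
      (T (⟨x₁ s, h₁.mem_domain s hs.le⟩ - ⟨x₂ s, h₂.mem_domain s hs.le⟩)) s := fun s hs => by
    rw [T.map_sub]
    exact (h₁.hasDerivAt s hs).sub (h₂.hasDerivAt s hs)
  have norm_le := norm_le_of_re_inner_deriv_nonpos (u := fun s => x₁ s - x₂ s)
    (u' := deriv fun s => x₁ s - x₂ s) (h₁.continuousOn.sub h₂.continuousOn)
    (fun s hs => (hasDerivAt_sub s hs).differentiableAt.hasDerivAt)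
    (fun s hs => (hasDerivAt_sub s hs).deriv ▸ dissipative _) ht
  rw [h₁.initial, h₂.initial, sub_self, norm_zero] at norm_le
  exact sub_eq_zero.1 (norm_le_zero_iff.1 norm_le)

lemma re_inner_nonpos_of_tendsto_slope {S : ℝ → H →L[ℂ] H} {x y : H}
    (norm_le : ∀ t, ‖S t x‖ ≤ ‖x‖)
    (tendsto_slope : Tendsto (fun t : ℝ => t⁻¹ • (S t x - x)) (𝓝[>] 0) (𝓝 y)) :
    (inner ℂ y x).re ≤ 0 := by
  refine le_of_tendsto (Complex.continuous_re.continuousAt.tendsto.comp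
    (tendsto_slope.inner (tendsto_const_nhds (x := x)))) ?_
  filter_upwards [self_mem_nhdsWithin] with t ht
  have inner_self : (inner ℂ x x).re = ‖x‖ ^ 2 := inner_self_eq_norm_sq (𝕜 := ℂ) x
  have cauchy_schwarz : (inner ℂ (S t x) x).re ≤ ‖x‖ ^ 2 := by
    calc (inner ℂ (S t x) x).re ≤ ‖S t x‖ * ‖x‖ := re_inner_le_norm (𝕜 := ℂ) _ _
      _ ≤ ‖x‖ * ‖x‖ := mul_le_mul_of_nonneg_right (norm_le t) (norm_nonneg x)
      _ = ‖x‖ ^ 2 := (sq _).symm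
  rw [Function.comp_apply, ← Complex.coe_smul, inner_smul_left, Complex.conj_ofReal,
    Complex.re_ofReal_mul, inner_sub_left, Complex.sub_re, inner_self]
  exact mul_nonpos_of_nonneg_of_nonpos (inv_nonneg.2 (le_of_lt ht)) (sub_nonpos.2 cauchy_schwarz)

namespace IsDissipative

variable {K : H →L[ℂ] H}

lemma re_inner_nonpos_of_mem_graph_iff (hK : IsDissipative K)
    (hT : ∀ x y, (x, y) ∈ T.graph ↔ x = K y) (z : T.domain) : (inner ℂ (T z) z.1).re ≤ 0 := by
  have inner_symm : (inner ℂ (T z) (K (T z))).re = (inner ℂ (K (T z)) (T z)).re :=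
    inner_re_symm (𝕜 := ℂ) _ _
  rw [(hT z.1 (T z)).1 (T.mem_graph z), inner_symm]
  exact hK (T z)

variable [CompleteSpace H] (hK : IsDissipative K) (hinj : Function.Injective K)

theorem isC0Semigroup_semigroup : IsC0Semigroup (hK.semigroup hinj) where
  map_zero := hK.semigroup_zero hinj
  map_add _ _ hs ht := hK.semigroup_add hinj hs ht
  tendsto_zero x := by
    simpa only [hK.semigroup_zero hinj, one_apply_eq_self] using
      ((hK.continuous_semigroup_apply hinj x).tendsto 0).mono_left
        (nhdsWithin_le_nhds (s := Ioi 0))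

theorem isGenerator_semigroup (hT : ∀ x y, (x, y) ∈ T.graph ↔ x = K y) :
    IsGenerator (hK.semigroup hinj) T := fun x y => by
  refine ⟨fun h => (hT x y).1 h ▸ hK.tendsto_slope_semigroup hinj y, fun tendsto_slope => ?_⟩
  obtain ⟨u, hu⟩ : ∃ u, u - K u = y - x := ⟨resolvent K (1 : ℝ) (y - x), by
    simpa only [one_smul] using hK.smul_resolvent_sub one_pos (y - x)⟩
  have hxy : y - u = x - K u := by
    rw [sub_eq_sub_iff_add_eq_add] at hu ⊢
    rw [← hu, add_comm]
  -- `x - K u` is an eigenvector of the generator for the eigenvalue `1`, unless it vanishes.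
  have eigenvector : Tendsto (fun t : ℝ => t⁻¹ • (hK.semigroup hinj t (x - K u) - (x - K u)))
      (𝓝[>] 0) (𝓝 (x - K u)) := by
    rw [← hxy]
    refine (tendsto_slope.sub (hK.tendsto_slope_semigroup hinj u)).congr fun t => ?_
    rw [← smul_sub, hxy, map_sub, sub_sub_sub_comm]
  have x_eq : x = K u := sub_eq_zero.1 ((re_inner_self_nonpos (𝕜 := ℂ)).1
    (re_inner_nonpos_of_tendsto_slope (fun t => hK.norm_semigroup_apply_le hinj t _) eigenvector))
  rw [hT, x_eq, sub_eq_zero.1 (hxy.trans (sub_eq_zero.2 x_eq))]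

theorem isSolution_semigroup (hT : ∀ x y, (x, y) ∈ T.graph ↔ x = K y) {x₀ : H}
    (hx₀ : x₀ ∈ T.domain) : IsSolution T x₀ fun t => hK.semigroup hinj t x₀ := by
  obtain ⟨y, rfl⟩ : ∃ y, x₀ = K y := ⟨T ⟨x₀, hx₀⟩, (hT _ _).1 (T.mem_graph ⟨x₀, hx₀⟩)⟩
  have mem_graph : ∀ t, (hK.semigroup hinj t (K y), hK.semigroup hinj t y) ∈ T.graph := fun t =>
    (hT _ _).2 (hK.semigroup_apply_apply hinj t y)
  have mem_domain : ∀ t, hK.semigroup hinj t (K y) ∈ T.domain := fun t =>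
    LinearPMap.mem_domain_of_mem_graph (mem_graph t)
  have apply_eq : ∀ t, T ⟨hK.semigroup hinj t (K y), mem_domain t⟩ = hK.semigroup hinj t y :=
    fun t => T.mem_graph_snd_inj (T.mem_graph _) (mem_graph t) rfl
  refine ⟨?_, fun t _ => mem_domain t, (hK.continuous_semigroup_apply hinj _).continuousOn, ?_,
    hK.contDiffOn_semigroup_apply hinj y, fun t ht => ?_⟩
  · rw [hK.semigroup_zero hinj, one_apply_eq_self]
  · simp only [apply_eq]
    exact (hK.continuous_semigroup_apply hinj y).comp continuous_subtype_val
  · rw [apply_eq]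
    exact hK.hasDerivAt_semigroup_apply hinj ht y

end IsDissipative

end Generation

/-! ### The bounded inverse of the system operator -/

open StateSpace

variable {P : Params}

lemma StateSpace.two_mul_re_inner_weakDeriv_w (y : StateSpace P) (k : Fin 3) :
    2 * (inner ℂ (y.w k) (weakDeriv (y.w k))).re = -‖pointValue (y.w k) 0‖ ^ 2 := by
  have by_parts :=
    congrArg Complex.re ((hasWeakDeriv_w y k).inner_add_inner (hasWeakDeriv_w y k))
  have symm : (inner ℂ (weakDeriv (y.w k)) (y.w k)).re =
      (inner ℂ (y.w k) (weakDeriv (y.w k))).re := inner_re_symm (𝕜 := ℂ) _ _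
  simp only [y.pointValue_w_one, mul_zero, zero_sub, Complex.add_re, Complex.neg_re, symm,
    Complex.conj_mul', ← Complex.ofReal_pow, Complex.ofReal_re] at by_parts
  linarith

/-- The inverse of `𝒯`, with the adjoints as Riesz representatives of the terms of the form
computed in `inner_inverseT`. -/
def inverseT (P : Params) : StateSpace P →L[ℂ] StateSpace P :=
  ∑ k, ((velocity k).adjoint ∘L displacement k
    - (displacement k).adjoint ∘L (velocity k + ((2 * P.β * P.η : ℝ) : ℂ) • StateSpace.slope k)
    - (P.κ : ℂ) • ((slopeZero k).adjoint ∘L slopeZero k)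
    - ((P.β * P.η : ℝ) : ℂ) • ((displacementZero k).adjoint ∘L displacementZero k))

lemma inner_inverseT (φ y : StateSpace P) : inner ℂ φ (inverseT P y) =
    ∑ k, (inner ℂ (φ.v k) (y.w k)
      - inner ℂ (φ.w k) (y.v k + ((2 * P.β * P.η : ℝ) : ℂ) • weakDeriv (y.w k))
      - P.κ * ((starRingEnd ℂ) (pointValue (weakDeriv (φ.w k)) 0)
        * pointValue (weakDeriv (y.w k)) 0)
      - (P.β * P.η : ℝ) * ((starRingEnd ℂ) (pointValue (φ.w k) 0) * pointValue (y.w k) 0)) := by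
  rw [inverseT, _root_.sum_apply, inner_sum]
  refine Finset.sum_congr rfl fun k _ => ?_
  simp only [_root_.sub_apply, _root_.smul_apply, _root_.add_apply,
    ContinuousLinearMap.comp_apply, inner_sub_right, inner_smul_right,
    ContinuousLinearMap.adjoint_inner_right, velocity_apply, displacement_apply, slope_apply,
    slopeZero_apply, displacementZero_apply, RCLike.inner_apply]
  ring

lemma re_inner_inverseT (y : StateSpace P) : (inner ℂ (inverseT P y) y).re =
    -∑ k, P.κ * ‖pointValue (weakDeriv (y.w k)) 0‖ ^ 2 := by
  have symm : (inner ℂ (inverseT P y) y).re = (inner ℂ y (inverseT P y)).re :=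
    inner_re_symm (𝕜 := ℂ) (inverseT P y) y
  rw [symm, inner_inverseT, Complex.re_sum, ← Finset.sum_neg_distrib]
  refine Finset.sum_congr rfl fun k _ => ?_
  have cross_symm : (inner ℂ (y.v k) (y.w k)).re = (inner ℂ (y.w k) (y.v k)).re :=
    inner_re_symm (𝕜 := ℂ) _ _
  simp only [Complex.conj_mul', ← Complex.ofReal_pow, inner_add_right, inner_smul_right,
    Complex.sub_re, Complex.add_re, Complex.re_ofReal_mul, Complex.ofReal_re, cross_symm]
  linear_combination (-P.β * P.η) * y.two_mul_re_inner_weakDeriv_w k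

lemma isDissipative_inverseT : IsDissipative (inverseT P) := fun y => by
  rw [re_inner_inverseT, neg_nonpos]
  exact Finset.sum_nonneg fun k _ => mul_nonneg P.κ_nonneg (sq_nonneg _)

lemma opT_apply_v_add (x : (opT P).domain) (k : Fin 3) :
    (opT P x).v k + ((2 * P.β * P.η : ℝ) : ℂ) • weakDeriv (x.1.v k) =
      -weakDeriv^[4] (x.1.w k) + ((P.γ - P.η ^ 2 : ℝ) : ℂ) • weakDeriv^[2] (x.1.w k) := by
  rw [opT_apply_v, add_assoc, ← add_smul]
  simp

lemma inverseT_apply_opT (x : (opT P).domain) : inverseT P (opT P x) = x.1 := by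
  obtain ⟨w_mem, -, w''_one, slope_condition, joint_condition⟩ : x.1 ∈ (opA P).domain :=
    opT_domain P ▸ x.2
  refine ext_inner_left ℂ fun φ => ?_
  rw [inner_inverseT, inner_def, ← Finset.sum_add_distrib, ← sub_eq_zero,
    ← Finset.sum_sub_distrib]
  calc _ = ∑ k, -((starRingEnd ℂ) (pointValue (φ.w 0) 0) *
        (pointValue (weakDeriv^[3] (x.1.w k)) 0
          - (P.γ - P.η ^ 2) * pointValue (weakDeriv (x.1.w k)) 0
          + P.β * P.η * pointValue (x.1.v k) 0)) := Finset.sum_congr rfl fun k _ => by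
        have green := greens_identity (w_mem k) (φ.w_mem.1 k) (w''_one k)
          ((P.γ - P.η ^ 2 : ℝ) : ℂ)
        rw [opT_apply_w, opT_apply_v_add]
        rw [φ.w_mem.2 k 0] at green ⊢
        push_cast at green ⊢
        linear_combination -green +
          (starRingEnd ℂ) (pointValue (weakDeriv (φ.w k)) 0) * slope_condition k
    _ = 0 := by rw [Finset.sum_neg_distrib, ← Finset.mul_sum, joint_condition, mul_zero, neg_zero]

lemma inverseT_v (y : StateSpace P) : (inverseT P y).v = y.w := by
  funext k
  refine ext_inner_left ℂ fun h => ?_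
  have tested := inner_inverseT (StateSpace.mk 0 (Pi.single k h) (zero_mem _)) y
  have iterate_zero : weakDeriv^[2] 0 = 0 := iterate_weakDeriv_zero 2
  rw [inner_def] at tested
  simp only [w_mk, v_mk, Pi.zero_apply, iterate_zero, weakDeriv_zero, pointValue_zero zero_mem_unit,
    inner_zero_left, map_zero, mul_zero, zero_mul, add_zero, sub_zero,
    Finset.sum_const_zero, zero_add] at tested
  rw [Finset.sum_eq_single k, Finset.sum_eq_single k] at tested
  · simpa only [Pi.single_eq_same] using tested
  all_goals simp +contextual

lemma weak_form_inverseT (y : StateSpace P) {φ : Fin 3 → L2} (hφ : φ ∈ H2StarG) :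
    ∑ k, (inner ℂ (weakDeriv^[2] (φ k)) (weakDeriv^[2] ((inverseT P y).w k))
        + ((P.γ - P.η ^ 2 : ℝ) : ℂ) * inner ℂ (weakDeriv (φ k)) (weakDeriv ((inverseT P y).w k))
        + inner ℂ (φ k) (y.v k + ((2 * P.β * P.η : ℝ) : ℂ) • weakDeriv (y.w k))
        + (starRingEnd ℂ) (pointValue (weakDeriv (φ k)) 0)
          * (P.α * pointValue (weakDeriv ((inverseT P y).w k)) 0
            + P.κ * pointValue (weakDeriv (y.w k)) 0)
        + (starRingEnd ℂ) (pointValue (φ k) 0) * (P.β * P.η * pointValue (y.w k) 0)) = 0 := by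
  have tested := inner_inverseT (StateSpace.mk φ 0 hφ) y
  rw [inner_def, ← Finset.sum_add_distrib, ← sub_eq_zero, ← Finset.sum_sub_distrib] at tested
  rw [← tested]
  refine Finset.sum_congr rfl fun k _ => ?_
  simp only [w_mk, v_mk, Pi.zero_apply, inner_zero_left]
  push_cast
  ring

lemma single_mem_H2StarG (k : Fin 3) {φ : L2} (hφ : φ ∈ sobolevStar 2)
    (φ_zero : pointValue φ 0 = 0) : (Pi.single k φ : Fin 3 → L2) ∈ H2StarG := by
  have value_zero (j) : pointValue ((Pi.single k φ : Fin 3 → L2) j) 0 = 0 := by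
    rcases eq_or_ne j k with rfl | hj
    · rwa [Pi.single_eq_same]
    · rw [Pi.single_eq_of_ne hj, pointValue_zero zero_mem_unit]
  refine ⟨fun j => ?_, fun i j => by rw [value_zero, value_zero]⟩
  rcases eq_or_ne j k with rfl | hj
  · rwa [Pi.single_eq_same]
  · rw [Pi.single_eq_of_ne hj]
    exact zero_mem _

lemma weak_form_inverseT_single (y : StateSpace P) (k : Fin 3) {φ : L2} (hφ : φ ∈ sobolevStar 2)
    (φ_zero : pointValue φ 0 = 0) :
    inner ℂ (weakDeriv^[2] φ) (weakDeriv^[2] ((inverseT P y).w k))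
        + ((P.γ - P.η ^ 2 : ℝ) : ℂ) * inner ℂ (weakDeriv φ) (weakDeriv ((inverseT P y).w k))
        + inner ℂ φ (y.v k + ((2 * P.β * P.η : ℝ) : ℂ) • weakDeriv (y.w k))
        + (starRingEnd ℂ) (pointValue (weakDeriv φ) 0)
          * (P.α * pointValue (weakDeriv ((inverseT P y).w k)) 0
            + P.κ * pointValue (weakDeriv (y.w k)) 0) = 0 := by
  have weak_eq := weak_form_inverseT y (single_mem_H2StarG k hφ φ_zero)
  rw [Finset.sum_eq_single k] at weak_eq
  · simpa only [Pi.single_eq_same, φ_zero, map_zero, zero_mul, add_zero] using weak_eq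
  · intro j _ hj
    have iterate_zero : weakDeriv^[2] 0 = 0 := iterate_weakDeriv_zero 2
    simp only [Pi.single_eq_of_ne hj, iterate_zero, weakDeriv_zero, pointValue_zero zero_mem_unit,
      inner_zero_left, map_zero, zero_mul, mul_zero, add_zero]
  · exact fun hk => (hk (Finset.mem_univ k)).elim

lemma regularity_inverseT (y : StateSpace P) (k : Fin 3) :
    (inverseT P y).w k ∈ sobolev 4 ∧ pointValue (weakDeriv^[2] ((inverseT P y).w k)) 1 = 0 ∧
      -weakDeriv^[4] ((inverseT P y).w k)
        + ((P.γ - P.η ^ 2 : ℝ) : ℂ) • weakDeriv^[2] ((inverseT P y).w k)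
        = y.v k + ((2 * P.β * P.η : ℝ) : ℂ) • weakDeriv (y.w k) := by
  refine regularity_of_weak_solution ((inverseT P y).w_mem_sobolev_two k)
    fun φ hφ φ_zero φ'_zero => ?_
  have weak_eq := weak_form_inverseT_single y k hφ φ_zero
  rw [φ'_zero, map_zero, zero_mul] at weak_eq
  linear_combination weak_eq

lemma greens_identity_inverseT (y : StateSpace P) (k : Fin 3) {φ : L2} (hφ : φ ∈ sobolevStar 2) :
    inner ℂ (weakDeriv^[2] φ) (weakDeriv^[2] ((inverseT P y).w k))
        + ((P.γ - P.η ^ 2 : ℝ) : ℂ) * inner ℂ (weakDeriv φ) (weakDeriv ((inverseT P y).w k))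
        + inner ℂ φ (y.v k + ((2 * P.β * P.η : ℝ) : ℂ) • weakDeriv (y.w k))
      = (starRingEnd ℂ) (pointValue φ 0) * (pointValue (weakDeriv^[3] ((inverseT P y).w k)) 0
          - ((P.γ - P.η ^ 2 : ℝ) : ℂ) * pointValue (weakDeriv ((inverseT P y).w k)) 0)
        - (starRingEnd ℂ) (pointValue (weakDeriv φ) 0)
          * pointValue (weakDeriv^[2] ((inverseT P y).w k)) 0 := by
  obtain ⟨w_mem, w''_one, strong_eq⟩ := regularity_inverseT y k
  rw [← strong_eq]
  exact greens_identity w_mem hφ w''_one _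

lemma slope_condition_inverseT (y : StateSpace P) (k : Fin 3) :
    pointValue (weakDeriv^[2] ((inverseT P y).w k)) 0
      - P.α * pointValue (weakDeriv ((inverseT P y).w k)) 0
      - P.κ * pointValue (weakDeriv ((inverseT P y).v k)) 0 = 0 := by
  obtain ⟨φ, hφ, φ_zero, φ'_zero⟩ := exists_mem_sobolevStar_two 0 1
  have weak_eq := weak_form_inverseT_single y k hφ φ_zero
  have green := greens_identity_inverseT y k hφ
  rw [φ_zero, φ'_zero, map_zero, zero_mul, map_one] at green
  rw [φ'_zero, map_one] at weak_eq
  rw [inverseT_v]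
  linear_combination green - weak_eq

lemma joint_condition_inverseT (y : StateSpace P) :
    ∑ k, (pointValue (weakDeriv^[3] ((inverseT P y).w k)) 0
      - (P.γ - P.η ^ 2) * pointValue (weakDeriv ((inverseT P y).w k)) 0
      + P.β * P.η * pointValue ((inverseT P y).v k) 0) = 0 := by
  obtain ⟨φ, hφ, φ_zero, φ'_zero⟩ := exists_mem_sobolevStar_two 1 0
  rw [← weak_form_inverseT y (φ := fun _ => φ) ⟨fun _ => hφ, fun _ _ => rfl⟩]
  refine Finset.sum_congr rfl fun k _ => ?_
  have green := greens_identity_inverseT y k hφ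
  rw [green, φ_zero, φ'_zero, inverseT_v]
  simp

lemma inverseT_mem_domain (y : StateSpace P) : inverseT P y ∈ (opT P).domain := by
  rw [opT_domain]
  exact ⟨fun k => (regularity_inverseT y k).1, inverseT_v y ▸ y.w_mem,
    fun k => (regularity_inverseT y k).2.1, slope_condition_inverseT y, joint_condition_inverseT y⟩

lemma opT_apply_inverseT (y : StateSpace P) :
    opT P ⟨inverseT P y, inverseT_mem_domain y⟩ = y := by
  refine StateSpace.ext ?_ (funext fun k => ?_)
  · rw [opT_apply_w]
    exact inverseT_v y
  · have apply_v := opT_apply_v_add ⟨inverseT P y, inverseT_mem_domain y⟩ k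
    rw [(regularity_inverseT y k).2.2, inverseT_v] at apply_v
    exact add_right_cancel apply_v

lemma mem_graph_opT_iff (x y : StateSpace P) : (x, y) ∈ (opT P).graph ↔ x = inverseT P y := by
  rw [LinearPMap.mem_graph_iff]
  constructor
  · rintro ⟨z, rfl, rfl⟩
    exact (inverseT_apply_opT z).symm
  · rintro rfl
    exact ⟨⟨inverseT P y, inverseT_mem_domain y⟩, rfl, opT_apply_inverseT y⟩

lemma inverseT_injective : Function.Injective (inverseT P) := fun _ _ h =>
  (opT P).mem_graph_snd_inj ((mem_graph_opT_iff _ _).2 rfl) ((mem_graph_opT_iff _ _).2 rfl) h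

end PipeNetwork

end

theorem theorem2p1 (P : PipeNetwork.Params) :
    ∃ S : ℝ → PipeNetwork.StateSpace P →L[ℂ] PipeNetwork.StateSpace P,
      PipeNetwork.IsC0Semigroup S ∧
      (∀ t : ℝ, 0 ≤ t → ‖S t‖ ≤ 1) ∧
      PipeNetwork.IsGenerator S (PipeNetwork.opT P) ∧
      ∀ x₀ ∈ (PipeNetwork.opA P).domain,
        PipeNetwork.IsSolution (PipeNetwork.opT P) x₀ (fun t => S t x₀) ∧
        ∀ x : ℝ → PipeNetwork.StateSpace P, PipeNetwork.IsSolution (PipeNetwork.opT P) x₀ x →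
          ∀ t : ℝ, 0 ≤ t → x t = S t x₀ := by
  have dissipative := PipeNetwork.isDissipative_inverseT (P := P)
  have injective := PipeNetwork.inverseT_injective (P := P)
  have graph := PipeNetwork.mem_graph_opT_iff (P := P)
  refine ⟨dissipative.semigroup injective, dissipative.isC0Semigroup_semigroup injective,
    fun t _ => dissipative.norm_semigroup_le injective t,
    dissipative.isGenerator_semigroup injective graph, fun x₀ hx₀ => ?_⟩
  rw [← PipeNetwork.opT_domain] at hx₀
  have solution := dissipative.isSolution_semigroup injective graph hx₀
  exact ⟨solution, fun x hx t ht =>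
    hx.apply_eq (dissipative.re_inner_nonpos_of_mem_graph_iff graph) solution ht⟩
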